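/- Let $n\ge 1$. An $n$-square square-tiled surface is a connected closed translation surface obtained from $n$ unit squares by gluing, by translations, each right side to a left side and each top side to a bottom side; equivalently, it is a pair $(\sigma,\tau)$ of permutations of $\{1,\dots,n\}$ (right neighbour, top neighbour) generating a transitive group. Two of them are the same surface if they differ by a relabelling of the squares, i.e. by simultaneous conjugation of $(\sigma,\tau)$. The surface lies in the stratum $\mathcal H(2)$ if it has exactly one cone point (a point of total angle greater than $2\pi$) and the angle there is $6\pi$. A saddle connection is a straight segment whose endpoints are cone points and whose interior contains no cone point; a unit saddle is a saddle connection of length one. Theorem 1.4 (Unit saddles). Let $N(n)$ be the number of $n$-square square-tiled surfaces in $\mathcal H(2)$, and let $U(n)$ be the number of those that have a unit saddle. Then, as $n\to\infty$, $$N(n)=\Theta(n^3)\qquad\text{and}\qquad U(n)=\Theta(n^2).$$ Consequently a square-tiled surface chosen uniformly at random among the $n$-square surfaces in $\mathcal H(2)$ asymptotically almost surely has no unit saddle: $$\lim_{n\to\infty}\frac{N(n)-U(n)}{N(n)}=1 .$$ Here $f(n)=\Theta(g(n))$ means that there are constants $0<c\le C$ and $n_0$ with $c\,g(n)\le f(n)\le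 C\,g(n)$ for all $n\ge n_0$. -/

import Mathlib

open Filter Asymptotics Topology

namespace SquareTiled

/-- The closed unit square `[0,1] × [0,1]` in the plane `ℂ`. -/
def unitSquare : Set ℂ := Set.Icc (0 : ℝ) 1 ×ℂ Set.Icc (0 : ℝ) 1

/-- A connected square-tiled surface built from `n` labelled unit squares: the right side of square
`i` is glued by a translation to the left side of square `right i`, and its top side to the bottom
side of square `up i`. The surface is connected: any two squares are joined by a chain of gluings. -/
structure Tiling (n : ℕ) where
  right : Equiv.Perm (Fin n)
  up : Equiv.Perm (Fin n)
  connected : MulAction.IsPretransitive (Subgroup.closure {right, up}) (Fin n)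

variable {n : ℕ}

/-- Two labelled square-tiled surfaces are the same surface if they differ by a relabelling of the
squares that respects all gluings. -/
instance Tiling.setoid (n : ℕ) : Setoid (Tiling n) where
  r S T := ∃ e : Equiv.Perm (Fin n), ∀ i, e (S.right i) = T.right (e i) ∧ e (S.up i) = T.up (e i)
  iseqv :=
    { refl := fun _ => ⟨1, fun _ => ⟨rfl, rfl⟩⟩
      symm := by
        rintro S T ⟨e, he⟩
        refine ⟨e.symm, fun i => ⟨?_, ?_⟩⟩
        · rw [Equiv.symm_apply_eq, (he _).1, Equiv.apply_symm_apply]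
        · rw [Equiv.symm_apply_eq, (he _).2, Equiv.apply_symm_apply]
      trans := by
        rintro S T U ⟨e, he⟩ ⟨f, hf⟩
        refine ⟨e.trans f, fun i => ⟨?_, ?_⟩⟩
        · simp only [Equiv.trans_apply, (he i).1, (hf (e i)).1]
        · simp only [Equiv.trans_apply, (he i).2, (hf (e i)).2] }

namespace Tiling

variable (S : Tiling n)

/-- The side identifications between points of the squares. -/
inductive Glue : Fin n × unitSquare → Fin n × unitSquare → Prop
  | horizontal (i : Fin n) (z w : unitSquare) (hz : (z : ℂ).re = 1) (hw : (w : ℂ).re = 0)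
      (h : (z : ℂ).im = (w : ℂ).im) : Glue (i, z) (S.right i, w)
  | vertical (i : Fin n) (z w : unitSquare) (hz : (z : ℂ).im = 1) (hw : (w : ℂ).im = 0)
      (h : (z : ℂ).re = (w : ℂ).re) : Glue (i, z) (S.up i, w)

/-- The points of the surface: the disjoint union of the squares modulo the equivalence relation
generated by the side identifications. -/
def Surface : Type := Quot S.Glue

/-- The point of the surface given by a point of one of the squares. -/
def proj (p : Fin n × unitSquare) : S.Surface := Quot.mk S.Glue p

end Tiling

open Classical in
/-- The interior angle of the unit square at one of its points: `2π` at an interior point, `π` at a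
point inside a side, and `π / 2` at a corner. -/
noncomputable def interiorAngle (z : unitSquare) : ℝ :=
  2 * Real.pi * (if (z : ℂ).re = 0 ∨ (z : ℂ).re = 1 then 1 / 2 else 1)
    * (if (z : ℂ).im = 0 ∨ (z : ℂ).im = 1 then 1 / 2 else 1)

namespace Tiling

variable (S : Tiling n)

/-- The total angle around a point of the surface: the sum of the interior angles of the squares at
all the (finitely many) points of the squares that are glued to it. -/
noncomputable def coneAngle (x : S.Surface) : ℝ :=
  ∑ᶠ p : {p : Fin n × unitSquare // S.proj p = x}, interiorAngle p.1.2

/-- The cone points (singularities) of the surface. -/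
def IsConePoint (x : S.Surface) : Prop := 2 * Real.pi < S.coneAngle x

/-- The surface lies in the stratum `H(α₁, …, αₛ)`: it has exactly `s` cone points, and their angles
are `2π(α₁ + 1), …, 2π(αₛ + 1)`. -/
def InStratum {s : ℕ} (α : Fin s → ℕ) : Prop :=
  ∃ e : Fin s ≃ {x : S.Surface // S.IsConePoint x},
    ∀ i, S.coneAngle (e i) = 2 * Real.pi * (α i + 1)

/-- On the time interval `[a, b]` the path `c` moves in a straight line, with constant velocity `v`,
inside one closed square. -/
def IsStraightPiece (c : ℝ → S.Surface) (v : ℂ) (a b : ℝ) : Prop :=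
  ∃ (i : Fin n) (z : ℂ), ∀ t ∈ Set.Icc a b, ∃ h : z + (t : ℂ) * v ∈ unitSquare,
    c t = S.proj (i, ⟨z + (t : ℂ) * v, h⟩)

/-- `c` restricted to `[0, 1]` is a saddle connection with holonomy vector `v`: it has constant
velocity `v`, it starts and ends at cone points, and no point in between is a cone point.
(Constant velocity makes `c` a geodesic away from the cone points, since a point of angle `2π` has
exactly one outgoing ray in each direction.) -/
def IsSaddleConnection (c : ℝ → S.Surface) (v : ℂ) : Prop :=
  (∃ (N : ℕ) (t : ℕ → ℝ), Monotone t ∧ t 0 = 0 ∧ t N = 1 ∧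
      ∀ j < N, S.IsStraightPiece c v (t j) (t (j + 1))) ∧
    S.IsConePoint (c 0) ∧ S.IsConePoint (c 1) ∧ ∀ t ∈ Set.Ioo (0 : ℝ) 1, ¬ S.IsConePoint (c t)

/-- The surface has a unit saddle, that is, a saddle connection of length one. -/
def HasUnitSaddle : Prop := ∃ (c : ℝ → S.Surface) (v : ℂ), S.IsSaddleConnection c v ∧ ‖v‖ = 1

end Tiling

/-- The `n`-square surfaces (up to relabelling of the squares) in `H(2)`. -/
def surfacesH2 (n : ℕ) : Set (Quotient (Tiling.setoid n)) :=
  {X | ∃ S : Tiling n, ⟦S⟧ = X ∧ S.InStratum ![2]}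

/-- The `n`-square surfaces (up to relabelling of the squares) in `H(2)` with a unit saddle. -/
def unitSurfacesH2 (n : ℕ) : Set (Quotient (Tiling.setoid n)) :=
  {X | ∃ S : Tiling n, ⟦S⟧ = X ∧ S.InStratum ![2] ∧ S.HasUnitSaddle}

end SquareTiled

/-!
A surface is a pair `(r, u)` of permutations (right and upper neighbour). Gluing the corners of the
squares shows that the vertices of the surface are the cycles of the commutator `g` of `r` and `u`,
with cone angle `2π` times the length of the cycle (`Tiling.coneAngle_proj`). So the surface is in
`H(2)` exactly when `g` is a 3-cycle (`Tiling.inStratum_iff`). A saddle connection develops to a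
vector of the lattice `ℤ + iℤ`, so a unit saddle is a side of a square both ends of which are the
cone point (`Tiling.exists_of_hasUnitSaddle`).

Upper bounds. Let `a 0`, `a 1`, `a 2` be the squares moved by `g`, so the squares whose lower left
corner is the cone point. First returns of `r` to these squares give the three horizontal saddle
connections, and first returns of `u` to their rows give the heights of the horizontal cylinders
(`Cylinders`, `Tiling.exists_cylinders`). The surface is determined by the lengths and the order of
the saddle connections, the heights, and the twist of each cylinder
(`Cylinders.exists_equiv`). Seen from above, a row is permuted by `topRight r u = g⁻¹ r`, which is
conjugate to `r`. Comparing the cycles of the two leaves only two combinatorial types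
(`Cylinders.next_cases`, `Cylinders.exists_twists_of_two_rows`):
* one cylinder, of height `h` and circumference `n / h`; two lengths and the twist are free, which
  gives at most `∑ (n / h) ^ 3` surfaces;
* two cylinders, of heights `h₁`, `h₂` and circumferences `w < w + l`, with `w h₁ + (w + l) h₂ = n`;
  the twists take `w` and `w + l` values. With `h = h₁ + h₂` one has `w ≤ n / h` and
  `w + l ≤ n / h₂`, which gives at most `∑ (n / h) ^ 2 (n / h₂)` surfaces, summed over `h₂ < h`.

Both sums are `O(n ^ 3)`. A horizontal unit saddle means that one of the lengths is `1`. This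
removes one free parameter: one of the three lengths in the first case; in the second, either
`w = 1` and `h₁` is determined by `h₂` and `l`, or `l = 1` and `w`, `h₂` are the quotient and the
remainder of `n` divided by `h`. In each case at most `O(∑ (n / h) ^ 2) = O(n ^ 2)` surfaces remain.
Vertical unit saddles are reduced to horizontal ones by a reflection.

Lower bounds. The surfaces `rowTiling` with one cylinder of height one and saddle connections of
lengths `c`, `s - c`, `n - s` are pairwise different when `c` is at most `n / 4` and the other two
lengths exceed `n / 4`, because a relabelling commutes with the rotation `r` and has to preserve the
shortest saddle connection (`rowTiling_inj`). There are about `n ^ 3` choices of `c`, `s` and the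
twist, and about `n ^ 2` of them have `c = 1`, which makes the shortest saddle connection a unit
saddle.
-/

namespace SquareTiled

open Equiv

/-! ### Points and cone angles -/

/-- The point `x + i y` of the unit square. -/
def squarePoint (x y : ℝ) (hx : x ∈ Set.Icc (0 : ℝ) 1) (hy : y ∈ Set.Icc (0 : ℝ) 1) : unitSquare :=
  ⟨⟨x, y⟩, ⟨hx, hy⟩⟩

/-- The lower left corner of the unit square. -/
def origin : unitSquare := squarePoint 0 0 (by simp) (by simp)

/-- The representative in `[0, 1)` of a coordinate in `[0, 1]` modulo `1`. -/
noncomputable def fold (x : ℝ) : ℝ := if x = 1 then 0 else x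

lemma fold_mem {x : ℝ} (hx : x ∈ Set.Icc (0 : ℝ) 1) : fold x ∈ Set.Icc (0 : ℝ) 1 := by
  unfold fold; split_ifs <;> simp_all

lemma fold_eq_zero {x : ℝ} : fold x = 0 ↔ x = 0 ∨ x = 1 := by
  unfold fold; split_ifs with h <;> simp [h]

lemma fold_of_ne {x : ℝ} (h : x ≠ 1) : fold x = x := if_neg h

@[simp] lemma fold_zero : fold 0 = 0 := by simp [fold]

@[simp] lemma fold_one : fold 1 = 0 := by simp [fold]

lemma exists_int_of_fold_eq {x y : ℝ} (h : fold x = fold y) : ∃ k : ℤ, x - y = k := by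
  unfold fold at h
  split_ifs at h with h1 h2 h2
  · exact ⟨0, by simp [h1, h2]⟩
  · exact ⟨1, by simp [h1, ← h]⟩
  · exact ⟨-1, by simp [h2, h]⟩
  · exact ⟨0, by simp [h]⟩

lemma exists_int_of_fold_eq_zero {x : ℝ} (h : fold x = 0) : ∃ k : ℤ, x = k := by
  rcases fold_eq_zero.1 h with h | h
  · exact ⟨0, by simp [h]⟩
  · exact ⟨1, by simp [h]⟩

lemma re_mem (z : unitSquare) : (z : ℂ).re ∈ Set.Icc (0 : ℝ) 1 := z.2.1

lemma im_mem (z : unitSquare) : (z : ℂ).im ∈ Set.Icc (0 : ℝ) 1 := z.2.2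

lemma unitSquare_ext {z w : unitSquare} (h : (z : ℂ).re = (w : ℂ).re)
    (h' : (z : ℂ).im = (w : ℂ).im) : z = w :=
  Subtype.ext (Complex.ext h h')

namespace Tiling

variable {n : ℕ} (S : Tiling n)

/-- The commutator of the two gluing permutations. Its cycles are the vertices of the surface: it
moves a square to the next one (right, up, left, down) around its lower left corner. -/
def vertexPerm : Perm (Fin n) := S.right * S.up * (S.up * S.right)⁻¹

lemma vertexPerm_up_right (i : Fin n) : S.vertexPerm (S.up (S.right i)) = S.right (S.up i) := by
  simp [vertexPerm, Perm.mul_apply]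

/-- The square that contains a given point after its coordinates are folded into `[0, 1)`. At a
corner this depends on a choice: first to the right, then up. -/
noncomputable def anchor (p : Fin n × unitSquare) : Fin n :=
  (if (p.2 : ℂ).im = 1 then S.up else 1) ((if (p.2 : ℂ).re = 1 then S.right else 1) p.1)

/-- Two points of the squares have the same folded coordinates and lie in the same square after
folding, up to moving around a vertex. -/
def SameFold (p q : Fin n × unitSquare) : Prop :=
  fold (p.2 : ℂ).re = fold (q.2 : ℂ).re ∧ fold (p.2 : ℂ).im = fold (q.2 : ℂ).im ∧
    (S.anchor p = S.anchor q ∨ fold (p.2 : ℂ).re = 0 ∧ fold (p.2 : ℂ).im = 0 ∧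
      S.vertexPerm.SameCycle (S.anchor p) (S.anchor q))

lemma SameFold.refl (p : Fin n × unitSquare) : S.SameFold p p := ⟨rfl, rfl, Or.inl rfl⟩

variable {S} in
lemma SameFold.symm {p q : Fin n × unitSquare} (h : S.SameFold p q) : S.SameFold q p := by
  obtain ⟨h1, h2, h3⟩ := h
  refine ⟨h1.symm, h2.symm, ?_⟩
  rcases h3 with h3 | ⟨h3, h4, h5⟩
  · exact Or.inl h3.symm
  · exact Or.inr ⟨h1 ▸ h3, h2 ▸ h4, h5.symm⟩

variable {S} in
lemma SameFold.trans {p q s : Fin n × unitSquare} (h : S.SameFold p q) (h' : S.SameFold q s) :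
    S.SameFold p s := by
  obtain ⟨h1, h2, h3⟩ := h
  obtain ⟨k1, k2, k3⟩ := h'
  refine ⟨h1.trans k1, h2.trans k2, ?_⟩
  rcases h3 with h3 | ⟨h3, h4, h5⟩
  · rwa [h3, h1, h2]
  · rcases k3 with k3 | ⟨k3, k4, k5⟩
    · exact Or.inr ⟨h3, h4, k3 ▸ h5⟩
    · exact Or.inr ⟨h3, h4, h5.trans k5⟩

lemma Glue.sameFold {p q : Fin n × unitSquare} (h : S.Glue p q) : S.SameFold p q := by
  cases h with
  | horizontal i z w hz hw h =>
    refine ⟨by simp [hz, hw], by simp [h], Or.inl ?_⟩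
    simp [anchor, hz, hw, h]
  | vertical i z w hz hw h =>
    refine ⟨by simp [h], by simp [hz, hw], ?_⟩
    by_cases hr : (w : ℂ).re = 1
    · right
      refine ⟨by simp [h, hr], by simp [hz], ?_⟩
      have : S.vertexPerm (S.up (S.right i)) = S.right (S.up i) := S.vertexPerm_up_right i
      simp only [anchor, hz, hw, h, hr]
      simp only [if_true, zero_ne_one, if_false, Perm.one_apply, ← this]
      exact Perm.sameCycle_apply_right.2 (Perm.SameCycle.refl _ _)
    · left
      simp [anchor, hz, hw, h, hr]

lemma proj_right {y : ℝ} (hy : y ∈ Set.Icc (0 : ℝ) 1) (i : Fin n) :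
    S.proj (i, squarePoint 1 y (by simp) hy) = S.proj (S.right i, squarePoint 0 y (by simp) hy) :=
  Quot.sound (Glue.horizontal i _ _ rfl rfl rfl)

lemma proj_up {x : ℝ} (hx : x ∈ Set.Icc (0 : ℝ) 1) (i : Fin n) :
    S.proj (i, squarePoint x 1 hx (by simp)) = S.proj (S.up i, squarePoint x 0 hx (by simp)) :=
  Quot.sound (Glue.vertical i _ _ rfl rfl rfl)

lemma proj_eq_proj_fold (p : Fin n × unitSquare) :
    S.proj p = S.proj (S.anchor p,
      squarePoint (fold (p.2 : ℂ).re) (fold (p.2 : ℂ).im) (fold_mem (re_mem _))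
        (fold_mem (im_mem _))) := by
  obtain ⟨i, ⟨⟨x, y⟩, hx, hy⟩⟩ := p
  change S.proj (i, squarePoint x y hx hy) = _
  change x ∈ Set.Icc (0 : ℝ) 1 at hx
  change y ∈ Set.Icc (0 : ℝ) 1 at hy
  by_cases h1 : x = 1 <;> by_cases h2 : y = 1
  · subst h1; subst h2
    simp only [anchor, fold_one, if_true]
    rw [proj_right, proj_up]
  · subst h1
    simp only [anchor, fold_one, if_true, h2, fold_of_ne h2, if_false, Perm.one_apply]
    rw [proj_right]
  · subst h2
    simp only [anchor, fold_one, if_true, h1, fold_of_ne h1, if_false, Perm.one_apply]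
    rw [proj_up]
  · simp only [anchor, h1, fold_of_ne h1, h2, fold_of_ne h2, if_false, Perm.one_apply]

lemma proj_vertexPerm (j : Fin n) : S.proj (S.vertexPerm j, origin) = S.proj (j, origin) := by
  obtain ⟨i, rfl⟩ := (S.up * S.right).surjective j
  rw [Perm.mul_apply, vertexPerm_up_right]
  unfold origin
  rw [← proj_right, ← proj_up, ← proj_up, ← proj_right]

lemma proj_eq_of_sameCycle {i j : Fin n} (h : S.vertexPerm.SameCycle i j) :
    S.proj (i, origin) = S.proj (j, origin) := by
  obtain ⟨k, rfl⟩ := h.exists_nat_pow_eq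
  induction k with
  | zero => rfl
  | succ k ih =>
    rw [pow_succ', Perm.mul_apply, proj_vertexPerm]
    exact ih ⟨k, by simp⟩

/-- The points of the surface are the points of the half-open squares, except that the lower left
corners are identified along the cycles of `vertexPerm`. -/
lemma proj_eq_proj_iff {p q : Fin n × unitSquare} : S.proj p = S.proj q ↔ S.SameFold p q := by
  constructor
  · intro h
    induction Quot.eqvGen_exact h with
    | rel _ _ hglue => exact hglue.sameFold
    | refl => exact SameFold.refl S _
    | symm _ _ _ ih => exact (ih (Quot.eqvGen_sound ‹_›)).symm
    | trans _ _ _ _ _ ih ih' =>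
      exact (ih (Quot.eqvGen_sound ‹_›)).trans (ih' (Quot.eqvGen_sound ‹_›))
  · rintro ⟨h1, h2, h3⟩
    rw [S.proj_eq_proj_fold p, S.proj_eq_proj_fold q]
    rcases h3 with h3 | ⟨h3, h4, h5⟩
    · simp only [h1, h2, h3]
    · simp only [← h1, ← h2, h3, h4]
      exact S.proj_eq_of_sameCycle h5

end Tiling

open Classical in
/-- The coordinates in `[0, 1]` that fold to a given number in `[0, 1)`. -/
noncomputable def lifts (x : ℝ) : Finset ℝ := if x = 0 then {0, 1} else {x}

lemma mem_lifts {x y : ℝ} : y ∈ lifts (fold x) ↔ fold y = fold x := by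
  unfold lifts
  split_ifs with h
  · simp [h, fold_eq_zero]
  · have hx : x ≠ 1 := fun hx => h (by simp [hx])
    have hx' : x ≠ 0 := fun hx => h (by simp [hx])
    rw [Finset.mem_singleton, fold_of_ne hx]
    refine ⟨fun e => by rw [e, fold_of_ne hx], fun e => ?_⟩
    by_cases h1 : y = 1
    · simp [h1] at e; exact absurd e.symm hx'
    · rwa [fold_of_ne h1] at e

lemma mem_Icc_of_mem_lifts {x y : ℝ} (hx : x ∈ Set.Icc (0 : ℝ) 1) (h : y ∈ lifts x) :
    y ∈ Set.Icc (0 : ℝ) 1 := by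
  unfold lifts at h
  split_ifs at h
  · rcases Finset.mem_insert.1 h with h | h
    · simp [h]
    · simp [Finset.mem_singleton.1 h]
  · rwa [Finset.mem_singleton.1 h]

open Classical in
/-- The share of a coordinate in the interior angle: `1 / 2` on the boundary, `1` inside. -/
noncomputable def weight (x : ℝ) : ℝ := if x = 0 ∨ x = 1 then 1 / 2 else 1

lemma interiorAngle_eq (z : unitSquare) :
    interiorAngle z = 2 * Real.pi * weight (z : ℂ).re * weight (z : ℂ).im := rfl

lemma sum_weight_lifts (x : ℝ) : ∑ y ∈ lifts (fold x), weight y = 1 := by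
  unfold lifts
  split_ifs with h
  · rw [Finset.sum_pair zero_ne_one]; norm_num [weight]
  · rw [Finset.sum_singleton]
    have hx : x ≠ 1 := fun hx => h (by simp [hx])
    rw [fold_of_ne hx] at h ⊢
    simp [weight, hx, h]

namespace Tiling

variable {n : ℕ} (S : Tiling n)

open Classical in
/-- The squares at whose folded copy a point of the surface can be seen: all the squares around a
vertex, and a single square at any other point. -/
noncomputable def star (p : Fin n × unitSquare) : Finset (Fin n) :=
  if fold (p.2 : ℂ).re = 0 ∧ fold (p.2 : ℂ).im = 0 then
    Finset.univ.filter (S.vertexPerm.SameCycle (S.anchor p)) else {S.anchor p}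

lemma mem_star {p : Fin n × unitSquare} {j : Fin n} :
    j ∈ S.star p ↔ S.anchor p = j ∨ fold (p.2 : ℂ).re = 0 ∧ fold (p.2 : ℂ).im = 0 ∧
      S.vertexPerm.SameCycle (S.anchor p) j := by
  unfold star
  split_ifs with h
  · simp only [Finset.mem_filter, Finset.mem_univ, true_and, h]
    refine ⟨Or.inr, ?_⟩
    rintro (rfl | h)
    · rfl
    · exact h
  · rw [Finset.mem_singleton, eq_comm]
    tauto

/-- The points glued to `p` correspond to the squares of its star together with a lift of each of
its two folded coordinates, and for each square the weights of the lifts add up to `1`. -/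
lemma coneAngle_proj (p : Fin n × unitSquare) :
    S.coneAngle (S.proj p) = 2 * Real.pi * (S.star p).card := by
  set x := fold (p.2 : ℂ).re with hx
  set y := fold (p.2 : ℂ).im with hy
  let T : Finset (Fin n × ℝ × ℝ) := S.star p ×ˢ lifts x ×ˢ lifts y
  have key (q : Fin n × unitSquare) :
      S.proj q = S.proj p ↔ (S.anchor q, (q.2 : ℂ).re, (q.2 : ℂ).im) ∈ T := by
    rw [eq_comm, proj_eq_proj_iff]
    simp only [T, Finset.mem_product, hx, hy, mem_lifts, mem_star,
      SameFold]
    tauto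
  let f : {q // S.proj q = S.proj p} → T := fun q => ⟨_, (key q.1).1 q.2⟩
  have hf : Function.Bijective f := by
    constructor
    · rintro ⟨⟨i, z⟩, hz⟩ ⟨⟨j, w⟩, hw⟩ h
      simp only [f, Subtype.mk.injEq, Prod.mk.injEq] at h
      obtain ⟨h1, h2, h3⟩ := h
      obtain rfl := unitSquare_ext h2 h3
      simp only [anchor, EmbeddingLike.apply_eq_iff_eq] at h1
      simp [h1]
    · rintro ⟨⟨i, a, b⟩, h⟩
      have h' := h
      simp only [T, Finset.mem_product] at h'
      let z : unitSquare := squarePoint a b (mem_Icc_of_mem_lifts (fold_mem (re_mem _)) h'.2.1)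
        (mem_Icc_of_mem_lifts (fold_mem (im_mem _)) h'.2.2)
      let j := ((if b = 1 then S.up else 1) * (if a = 1 then S.right else 1))⁻¹ i
      have hj : S.anchor (j, z) = i := by
        change ((if b = 1 then S.up else 1) * (if a = 1 then S.right else 1)) j = i
        exact Equiv.apply_symm_apply _ i
      have hz : (S.anchor (j, z), (z : ℂ).re, (z : ℂ).im) = (i, a, b) := by rw [hj]; rfl
      exact ⟨⟨(j, z), (key (j, z)).2 (hz ▸ h)⟩, Subtype.ext hz⟩
  unfold coneAngle
  rw [finsum_eq_of_bijective (g := fun t : T => 2 * Real.pi * weight t.1.2.1 * weight t.1.2.2) f hf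
    (fun q => interiorAngle_eq _), finsum_eq_sum_of_fintype,
    Finset.sum_coe_sort T (fun t => 2 * Real.pi * weight t.2.1 * weight t.2.2)]
  simp only [T, Finset.sum_product, mul_assoc, ← Finset.mul_sum]
  simp only [hx, hy, sum_weight_lifts, mul_one, Finset.sum_const, nsmul_eq_mul]

lemma isConePoint_iff (p : Fin n × unitSquare) : S.IsConePoint (S.proj p) ↔
    fold (p.2 : ℂ).re = 0 ∧ fold (p.2 : ℂ).im = 0 ∧ S.anchor p ∈ S.vertexPerm.support := by
  rw [IsConePoint, coneAngle_proj, lt_mul_iff_one_lt_right (by positivity), Nat.one_lt_cast]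
  by_cases h : fold (p.2 : ℂ).re = 0 ∧ fold (p.2 : ℂ).im = 0
  · simp only [h, true_and, Finset.one_lt_card_iff, mem_star, Perm.mem_support]
    constructor
    · rintro ⟨a, b, ha, hb, hab⟩ hfix
      have fix (c) (hc : S.anchor p = c ∨ S.vertexPerm.SameCycle (S.anchor p) c) :
          S.anchor p = c := by
        rcases hc with hc | hc
        · exact hc
        · exact hc.eq_of_left hfix
      exact hab ((fix a ha).symm.trans (fix b hb))
    · intro hne
      refine ⟨_, _, Or.inl rfl, Or.inr ?_, hne.symm⟩
      exact Perm.sameCycle_apply_right.2 (Perm.SameCycle.refl _ _)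
  · have : (S.star p).card = 1 := by
      unfold star
      rw [if_neg h, Finset.card_singleton]
    simp only [this, lt_irrefl, false_iff]
    tauto

lemma isConePoint_origin (i : Fin n) :
    S.IsConePoint (S.proj (i, origin)) ↔ i ∈ S.vertexPerm.support := by
  rw [isConePoint_iff]
  simp [origin, squarePoint, anchor]

lemma exists_origin_of_isConePoint {x : S.Surface} (hx : S.IsConePoint x) :
    ∃ i, x = S.proj (i, origin) := by
  induction x using Quot.ind with
  | mk p =>
    change S.IsConePoint (S.proj p) at hx
    obtain ⟨h1, h2, -⟩ := (S.isConePoint_iff p).1 hx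
    refine ⟨S.anchor p, (S.proj_eq_proj_fold p).trans ?_⟩
    simp only [h1, h2, origin]

lemma proj_origin_eq_iff {i j : Fin n} :
    S.proj (i, origin) = S.proj (j, origin) ↔ S.vertexPerm.SameCycle i j := by
  refine ⟨fun h => ?_, S.proj_eq_of_sameCycle⟩
  have := (S.proj_eq_proj_iff.1 h).2.2
  simp only [origin, squarePoint, anchor] at this
  simp at this
  rcases this with rfl | h
  · rfl
  · exact h

lemma coneAngle_origin (i : Fin n) : S.coneAngle (S.proj (i, origin)) =
    2 * Real.pi * (Finset.univ.filter (S.vertexPerm.SameCycle i)).card := by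
  have ha : S.anchor (i, origin) = i := by simp [origin, squarePoint, anchor]
  rw [coneAngle_proj, star, if_pos (by simp [origin, squarePoint]), ha]

/-- A square-tiled surface is in `H(2)` exactly when its vertex permutation is a 3-cycle. -/
theorem inStratum_iff : S.InStratum ![2] ↔ S.vertexPerm.support.card = 3 := by
  have hpi : (2 * Real.pi) ≠ 0 := by positivity
  have sub (i : Fin n) (hi : i ∈ S.vertexPerm.support) :
      Finset.univ.filter (S.vertexPerm.SameCycle i) ⊆ S.vertexPerm.support := by
    intro j hj
    have hj : S.vertexPerm.SameCycle i j := (Finset.mem_filter.1 hj).2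
    exact Perm.mem_support.2 (fun h => Perm.mem_support.1 hi (hj.apply_eq_self_iff.2 h))
  constructor
  · rintro ⟨e, he⟩
    obtain ⟨⟨x, hx⟩, hex⟩ : ∃ x, e 0 = x := ⟨_, rfl⟩
    obtain ⟨i, rfl⟩ := S.exists_origin_of_isConePoint hx
    have h0 := he 0
    rw [hex, coneAngle_origin, mul_right_inj' hpi] at h0
    have hi := (S.isConePoint_origin i).1 hx
    have : Finset.univ.filter (S.vertexPerm.SameCycle i) = S.vertexPerm.support := by
      refine (sub i hi).antisymm fun j hj => ?_
      have hjc := (S.isConePoint_origin j).2 hj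
      have : e (e.symm ⟨_, hjc⟩) = e 0 := by rw [Subsingleton.elim (e.symm _) 0]
      rw [Equiv.apply_symm_apply, hex, Subtype.mk.injEq, proj_origin_eq_iff] at this
      simpa using this.symm
    rw [this] at h0
    simp only [Matrix.cons_val_zero] at h0
    norm_cast at h0
  · intro h
    have hc : S.vertexPerm.IsCycle := (card_support_eq_three_iff.1 h).isCycle
    obtain ⟨i, hi, hcyc⟩ := hc
    have hi' : i ∈ S.vertexPerm.support := Perm.mem_support.2 hi
    have : Finset.univ.filter (S.vertexPerm.SameCycle i) = S.vertexPerm.support := by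
      refine (sub i hi').antisymm fun j hj => ?_
      simpa using hcyc (Perm.mem_support.1 hj)
    have hcone := (S.isConePoint_origin i).2 hi'
    have uniq (x : {x : S.Surface // S.IsConePoint x}) : x = ⟨_, hcone⟩ := by
      obtain ⟨x, hx⟩ := x
      obtain ⟨j, rfl⟩ := S.exists_origin_of_isConePoint hx
      have hj := (S.isConePoint_origin j).1 hx
      exact Subtype.ext (S.proj_origin_eq_iff.2 (hcyc (Perm.mem_support.1 hj)).symm)
    refine ⟨⟨fun _ => ⟨_, hcone⟩, fun _ => 0, fun _ => Subsingleton.elim _ _,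
      fun x => (uniq x).symm⟩, fun k => ?_⟩
    change S.coneAngle (S.proj (i, origin)) = _
    rw [coneAngle_origin, this, h, Subsingleton.elim k 0]
    norm_num

end Tiling

/-! ### Unit saddles -/

/-- The lattice `ℤ + iℤ` in the plane. -/
def gaussLattice : AddSubgroup ℂ where
  carrier := {z | (∃ k : ℤ, z.re = k) ∧ ∃ l : ℤ, z.im = l}
  add_mem' := by
    rintro a b ⟨⟨k, hk⟩, l, hl⟩ ⟨⟨k', hk'⟩, l', hl'⟩
    exact ⟨⟨k + k', by simp [hk, hk']⟩, l + l', by simp [hl, hl']⟩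
  zero_mem' := ⟨⟨0, by simp⟩, 0, by simp⟩
  neg_mem' := by
    rintro a ⟨⟨k, hk⟩, l, hl⟩
    exact ⟨⟨-k, by simp [hk]⟩, -l, by simp [hl]⟩

lemma eq_of_mem_gaussLattice_of_norm_eq_one {v : ℂ} (hv : v ∈ gaussLattice) (h1 : ‖v‖ = 1) :
    v = 1 ∨ v = -1 ∨ v = Complex.I ∨ v = -Complex.I := by
  obtain ⟨⟨k, hk⟩, l, hl⟩ := hv
  have h2 : k * k + l * l = 1 := by
    have := Complex.sq_norm v
    rw [h1, Complex.normSq_apply, hk, hl] at this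
    exact_mod_cast (this.symm.trans (one_pow 2))
  have hk' : -1 ≤ k ∧ k ≤ 1 := ⟨by nlinarith, by nlinarith⟩
  obtain ⟨hk1, hk2⟩ := hk'
  have cases : (k = 1 ∧ l = 0) ∨ (k = -1 ∧ l = 0) ∨ (k = 0 ∧ l = 1) ∨ (k = 0 ∧ l = -1) := by
    interval_cases k
    · have : l = 0 := by nlinarith
      tauto
    · have : (l - 1) * (l + 1) = 0 := by linarith
      rcases mul_eq_zero.1 this with h | h
      · have : l = 1 := by omega
        tauto
      · have : l = -1 := by omega
        tauto
    · have : l = 0 := by nlinarith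
      tauto
  rcases cases with ⟨rfl, rfl⟩ | ⟨rfl, rfl⟩ | ⟨rfl, rfl⟩ | ⟨rfl, rfl⟩
  · exact Or.inl (Complex.ext (by simp [hk]) (by simp [hl]))
  · exact Or.inr (Or.inl (Complex.ext (by simp [hk]) (by simp [hl])))
  · exact Or.inr (Or.inr (Or.inl (Complex.ext (by simp [hk]) (by simp [hl]))))
  · exact Or.inr (Or.inr (Or.inr (Complex.ext (by simp [hk]) (by simp [hl]))))

namespace Tiling

variable {n : ℕ} (S : Tiling n)

lemma sub_mem_gaussLattice {i j : Fin n} {z w : unitSquare} (h : S.proj (i, z) = S.proj (j, w)) :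
    (z : ℂ) - w ∈ gaussLattice := by
  obtain ⟨h1, h2, -⟩ := S.proj_eq_proj_iff.1 h
  exact ⟨by simpa using exists_int_of_fold_eq h1, by simpa using exists_int_of_fold_eq h2⟩

lemma mem_gaussLattice_of_isConePoint {i : Fin n} {z : unitSquare}
    (h : S.IsConePoint (S.proj (i, z))) : (z : ℂ) ∈ gaussLattice := by
  obtain ⟨h1, h2, -⟩ := (S.isConePoint_iff _).1 h
  exact ⟨exists_int_of_fold_eq_zero h1, exists_int_of_fold_eq_zero h2⟩

lemma eq_of_proj_eq {i j : Fin n} {z : unitSquare} (h : S.proj (i, z) = S.proj (j, z))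
    (hz : ¬ (fold (z : ℂ).re = 0 ∧ fold (z : ℂ).im = 0)) : i = j := by
  obtain ⟨-, -, h | ⟨h1, h2, -⟩⟩ := S.proj_eq_proj_iff.1 h
  · simpa [anchor] using h
  · exact absurd ⟨h1, h2⟩ hz

/-- A path of straight pieces starting and ending at cone points develops along the lattice, since
the coordinates of the squares agree modulo the lattice. -/
lemma lattice_of_pieces {c : ℝ → S.Surface} {v : ℂ} {N : ℕ} {t : ℕ → ℝ} (ht : Monotone t)
    (h0 : t 0 = 0) (hN : t N = 1) (hp : ∀ j < N, S.IsStraightPiece c v (t j) (t (j + 1)))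
    (hc0 : S.IsConePoint (c 0)) (hc1 : S.IsConePoint (c 1)) :
    v ∈ gaussLattice ∧ ∀ j < N, ∃ i, ∃ z ∈ gaussLattice, ∀ s ∈ Set.Icc (t j) (t (j + 1)),
      ∃ h : z + (s : ℂ) * v ∈ unitSquare, c s = S.proj (i, ⟨z + (s : ℂ) * v, h⟩) := by
  have pieces : ∀ j < N, ∃ i, ∃ z ∈ gaussLattice, ∀ s ∈ Set.Icc (t j) (t (j + 1)),
      ∃ h : z + (s : ℂ) * v ∈ unitSquare, c s = S.proj (i, ⟨z + (s : ℂ) * v, h⟩) := by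
    intro j
    induction j with
    | zero =>
      intro hj
      obtain ⟨i, z, hz⟩ := hp 0 hj
      obtain ⟨h, hc⟩ := hz 0 ⟨h0.le, h0 ▸ ht (Nat.le_succ 0)⟩
      have := S.mem_gaussLattice_of_isConePoint (hc ▸ hc0)
      exact ⟨i, z, by simpa using this, hz⟩
    | succ j ih =>
      intro hj
      obtain ⟨i, z, hzl, hz⟩ := ih (by omega)
      obtain ⟨i', z', hz'⟩ := hp (j + 1) hj
      refine ⟨i', z', ?_, hz'⟩
      obtain ⟨h, hc⟩ := hz (t (j + 1)) ⟨ht (Nat.le_succ j), le_rfl⟩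
      obtain ⟨h', hc'⟩ := hz' (t (j + 1)) ⟨le_rfl, ht (Nat.le_succ _)⟩
      have := S.sub_mem_gaussLattice (hc'.symm.trans hc)
      simp only [add_sub_add_right_eq_sub] at this
      simpa using add_mem this hzl
  refine ⟨?_, pieces⟩
  obtain ⟨M, rfl⟩ : ∃ M, N = M + 1 :=
    Nat.exists_eq_succ_of_ne_zero (by rintro rfl; rw [h0] at hN; exact zero_ne_one hN)
  obtain ⟨i, z, hzl, hz⟩ := pieces M (by omega)
  obtain ⟨h, hc⟩ := hz 1 ⟨hN ▸ ht (Nat.le_succ M), hN.ge⟩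
  have := S.mem_gaussLattice_of_isConePoint (hc ▸ hc1)
  simp only [Complex.ofReal_one, one_mul] at this
  simpa using sub_mem this hzl

/-- A path that runs with velocity `v` along sides, and meets no vertex at times in `(0, 1)`, stays
on one side. Here `w` is the starting point of the side of the unit square on which pieces of such a
path can be seen. -/
lemma exists_side_of_pieces {c : ℝ → S.Surface} {v w : ℂ} {N : ℕ} {t : ℕ → ℝ} (ht : Monotone t)
    (h0 : t 0 = 0) (hN : t N = 1)
    (hp : ∀ j < N, ∃ i, ∃ z ∈ gaussLattice, ∀ s ∈ Set.Icc (t j) (t (j + 1)),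
      ∃ h : z + (s : ℂ) * v ∈ unitSquare, c s = S.proj (i, ⟨z + (s : ℂ) * v, h⟩))
    (hw : ∀ s ∈ Set.Icc (0 : ℝ) 1, w + (s : ℂ) * v ∈ unitSquare)
    (hne : ∀ s ∈ Set.Ioo (0 : ℝ) 1,
      ¬ (fold (w + (s : ℂ) * v).re = 0 ∧ fold (w + (s : ℂ) * v).im = 0))
    (hmove : ∀ i, ∀ z ∈ gaussLattice, ∀ m ∈ Set.Ioo (0 : ℝ) 1, z + (m : ℂ) * v ∈ unitSquare →
      ∃ i', ∀ s (hs : s ∈ Set.Icc (0 : ℝ) 1) (h : z + (s : ℂ) * v ∈ unitSquare),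
        S.proj (i, ⟨z + (s : ℂ) * v, h⟩) = S.proj (i', ⟨w + (s : ℂ) * v, hw s hs⟩)) :
    ∃ i, ∀ s (hs : s ∈ Set.Icc (0 : ℝ) 1), c s = S.proj (i, ⟨w + (s : ℂ) * v, hw s hs⟩) := by
  have main : ∀ j ≤ N, t j = 0 ∨ ∃ i, ∀ s (hs : s ∈ Set.Icc (0 : ℝ) 1), s ≤ t j →
      c s = S.proj (i, ⟨w + (s : ℂ) * v, hw s hs⟩) := by
    intro j
    induction j with
    | zero => exact fun _ => Or.inl h0
    | succ j ih =>
      intro hj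
      have hj0 : 0 ≤ t j := h0 ▸ ht (Nat.zero_le j)
      have hj1 : t (j + 1) ≤ 1 := hN ▸ ht hj
      rcases (ht (Nat.le_succ j)).eq_or_lt with heq | hlt
      · rw [← Nat.succ_eq_add_one, ← heq]
        exact ih (by omega)
      rw [Nat.succ_eq_add_one] at hlt
      right
      obtain ⟨i, z, hzl, hz⟩ := hp j hj
      have hm : (t j + t (j + 1)) / 2 ∈ Set.Ioo (0 : ℝ) 1 := ⟨by linarith, by linarith⟩
      obtain ⟨hm', -⟩ := hz ((t j + t (j + 1)) / 2) ⟨by linarith, by linarith⟩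
      obtain ⟨i', hi'⟩ := hmove i z hzl _ hm hm'
      have hpiece (s) (hs : s ∈ Set.Icc (0 : ℝ) 1) (h : t j ≤ s) (h' : s ≤ t (j + 1)) :
          c s = S.proj (i', ⟨w + (s : ℂ) * v, hw s hs⟩) := by
        obtain ⟨hq, hc⟩ := hz s ⟨h, h'⟩
        rw [hc, hi' s hs hq]
      refine ⟨i', fun s hs hsj => ?_⟩
      rcases le_total (t j) s with h | h
      · exact hpiece s hs h hsj
      rcases ih (by omega) with ih | ⟨k, hk⟩
      · exact hpiece s hs (ih ▸ hs.1) hsj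
      rcases hj0.eq_or_lt with hz0 | hpos
      · exact hpiece s hs (hz0 ▸ hs.1) hsj
      -- at the common endpoint, which is not a vertex, the two sides are compared
      have hs' : t j ∈ Set.Icc (0 : ℝ) 1 := ⟨hj0, by linarith⟩
      have := (hk _ hs' le_rfl).symm.trans (hpiece _ hs' le_rfl hlt.le)
      rw [← S.eq_of_proj_eq this (hne _ ⟨hpos, by linarith⟩)]
      exact hk s hs h
  rcases main N le_rfl with h | ⟨i, hi⟩
  · rw [h] at hN; exact absurd hN zero_ne_one
  · exact ⟨i, fun s hs => hi s hs (hN ▸ hs.2)⟩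

/-- A unit saddle is a side of a square both ends of which are cone points. -/
theorem exists_of_hasUnitSaddle (h : S.HasUnitSaddle) : ∃ i ∈ S.vertexPerm.support,
    S.right i ∈ S.vertexPerm.support ∨ S.up i ∈ S.vertexPerm.support := by
  obtain ⟨c, v, ⟨⟨N, t, ht, h0, hN, hp⟩, hc0, hc1, -⟩, hv⟩ := h
  obtain ⟨hvl, hp⟩ := S.lattice_of_pieces ht h0 hN hp hc0 hc1
  have zero_of {k : ℤ} {s : ℝ} (hs : s ∈ Set.Ioo (0 : ℝ) 1) (h : (k : ℝ) + s ∈ Set.Icc (0 : ℝ) 1) :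
      k = 0 := by
    have h1 : (-1 : ℝ) < k := by linarith [h.1, hs.2]
    have h2 : (k : ℝ) < 1 := by linarith [h.2, hs.1]
    norm_cast at h1 h2
    have : -1 < k := by exact_mod_cast h1
    omega
  have one_of {k : ℤ} {s : ℝ} (hs : s ∈ Set.Ioo (0 : ℝ) 1) (h : (k : ℝ) - s ∈ Set.Icc (0 : ℝ) 1) :
      k = 1 := by
    have h1 : (0 : ℝ) < k := by linarith [h.1, hs.1]
    have h2 : (k : ℝ) < 2 := by linarith [h.2, hs.2]
    norm_cast at h1 h2
    have : k < 2 := by exact_mod_cast h2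
    omega
  have zero_or_one {k : ℤ} (h : (k : ℝ) ∈ Set.Icc (0 : ℝ) 1) : k = 0 ∨ k = 1 := by
    have h1 : 0 ≤ k := by exact_mod_cast h.1
    have h2 : k ≤ 1 := by exact_mod_cast h.2
    omega
  have h01 : (0 : ℝ) ∈ Set.Icc (0 : ℝ) 1 := by simp
  have h11 : (1 : ℝ) ∈ Set.Icc (0 : ℝ) 1 := by simp
  have hz (z : ℂ) (i : Fin n) (hz : z ∈ unitSquare) (hc : S.IsConePoint (S.proj (i, ⟨z, hz⟩))) :
      S.anchor (i, ⟨z, hz⟩) ∈ S.vertexPerm.support := ((S.isConePoint_iff _).1 hc).2.2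
  -- a piece moving horizontally lies on the bottom or the top side of its square; on the top side,
  -- it lies on the bottom side of the square above. Vertical pieces are moved to left sides.
  rcases eq_of_mem_gaussLattice_of_norm_eq_one hvl hv with rfl | rfl | rfl | rfl
  · obtain ⟨i, hi⟩ := S.exists_side_of_pieces (w := 0) ht h0 hN hp
      (fun s hs => ⟨by simpa using hs, by simp⟩)
      (fun s hs => by simp [fold_eq_zero, hs.1.ne', hs.2.ne]) (by
        rintro i z ⟨⟨k, hk⟩, l, hl⟩ m hm ⟨hz1, hz2⟩
        have hk0 := zero_of hm (k := k) (by simpa [hk] using hz1)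
        subst hk0
        rcases zero_or_one (k := l) (by simpa [hl] using hz2) with rfl | rfl
        · exact ⟨i, fun s hs h => congrArg S.proj (Prod.ext rfl
            (unitSquare_ext (by simp [hk]) (by simp [hl])))⟩
        · exact ⟨S.up i, fun s hs h => Quot.sound
            (Glue.vertical i _ _ (by simp [hl]) (by simp) (by simp [hk]))⟩)
    have e0 := hz _ _ _ (hi 0 h01 ▸ hc0)
    have e1 := hz _ _ _ (hi 1 h11 ▸ hc1)
    exact ⟨i, by simpa [anchor] using e0, Or.inl (by simpa [anchor] using e1)⟩
  · obtain ⟨i, hi⟩ := S.exists_side_of_pieces (w := 1) ht h0 hN hp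
      (fun s hs => ⟨by simpa [and_comm] using hs, by simp⟩)
      (fun s hs => by
        have := hs.1.ne'
        have := sub_ne_zero.2 hs.2.ne'
        simp_all [fold_eq_zero, ← sub_eq_add_neg]) (by
        rintro i z ⟨⟨k, hk⟩, l, hl⟩ m hm ⟨hz1, hz2⟩
        have hk0 := one_of hm (k := k) (by simpa [hk, ← sub_eq_add_neg] using hz1)
        subst hk0
        rcases zero_or_one (k := l) (by simpa [hl] using hz2) with rfl | rfl
        · exact ⟨i, fun s hs h => congrArg S.proj (Prod.ext rfl
            (unitSquare_ext (by simp [hk]) (by simp [hl])))⟩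
        · exact ⟨S.up i, fun s hs h => Quot.sound
            (Glue.vertical i _ _ (by simp [hl]) (by simp) (by simp [hk]))⟩)
    have e0 := hz _ _ _ (hi 0 h01 ▸ hc0)
    have e1 := hz _ _ _ (hi 1 h11 ▸ hc1)
    exact ⟨i, by simpa [anchor] using e1, Or.inl (by simpa [anchor] using e0)⟩
  · obtain ⟨i, hi⟩ := S.exists_side_of_pieces (w := 0) ht h0 hN hp
      (fun s hs => ⟨by simp, by simpa using hs⟩)
      (fun s hs => by simp [fold_eq_zero, hs.1.ne', hs.2.ne]) (by
        rintro i z ⟨⟨k, hk⟩, l, hl⟩ m hm ⟨hz1, hz2⟩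
        have hk0 := zero_of hm (k := l) (by simpa [hl] using hz2)
        subst hk0
        rcases zero_or_one (k := k) (by simpa [hk] using hz1) with rfl | rfl
        · exact ⟨i, fun s hs h => congrArg S.proj (Prod.ext rfl
            (unitSquare_ext (by simp [hk]) (by simp [hl])))⟩
        · exact ⟨S.right i, fun s hs h => Quot.sound
            (Glue.horizontal i _ _ (by simp [hk]) (by simp) (by simp [hl]))⟩)
    have e0 := hz _ _ _ (hi 0 h01 ▸ hc0)
    have e1 := hz _ _ _ (hi 1 h11 ▸ hc1)
    exact ⟨i, by simpa [anchor] using e0, Or.inr (by simpa [anchor] using e1)⟩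
  · obtain ⟨i, hi⟩ := S.exists_side_of_pieces (w := Complex.I) ht h0 hN hp
      (fun s hs => ⟨by simp, by simpa [and_comm] using hs⟩)
      (fun s hs => by
        have := hs.1.ne'
        have := sub_ne_zero.2 hs.2.ne'
        simp_all [fold_eq_zero, ← sub_eq_add_neg]) (by
        rintro i z ⟨⟨k, hk⟩, l, hl⟩ m hm ⟨hz1, hz2⟩
        have hk0 := one_of hm (k := l) (by simpa [hl, ← sub_eq_add_neg] using hz2)
        subst hk0
        rcases zero_or_one (k := k) (by simpa [hk] using hz1) with rfl | rfl
        · exact ⟨i, fun s hs h => congrArg S.proj (Prod.ext rfl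
            (unitSquare_ext (by simp [hk]) (by simp [hl])))⟩
        · exact ⟨S.right i, fun s hs h => Quot.sound
            (Glue.horizontal i _ _ (by simp [hk]) (by simp) (by simp [hl]))⟩)
    have e0 := hz _ _ _ (hi 0 h01 ▸ hc0)
    have e1 := hz _ _ _ (hi 1 h11 ▸ hc1)
    exact ⟨i, by simpa [anchor] using e1, Or.inr (by simpa [anchor] using e0)⟩

lemma hasUnitSaddle_of_right {i : Fin n} (hi : i ∈ S.vertexPerm.support)
    (hr : S.right i ∈ S.vertexPerm.support) : S.HasUnitSaddle := by
  let c : ℝ → S.Surface := fun t =>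
    S.proj (i, squarePoint (max 0 (min 1 t)) 0 (by simp) (by simp))
  refine ⟨c, 1, ⟨⟨1, fun j => if j = 0 then 0 else 1, ?_, by simp, by simp, ?_⟩, ?_, ?_, ?_⟩,
    by simp⟩
  · intro j k hjk
    by_cases hj : j = 0 <;> by_cases hk : k = 0 <;> simp [hj, hk]
    omega
  · intro j hj
    obtain rfl : j = 0 := by omega
    refine ⟨i, 0, fun s hs => ?_⟩
    simp only [if_true, zero_add, one_ne_zero, if_false] at hs
    refine ⟨⟨by simpa using hs, by simp⟩, congrArg S.proj (Prod.ext rfl (unitSquare_ext ?_ ?_))⟩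
    · simp [squarePoint, hs.1, hs.2]
    · simp [squarePoint]
  · rw [isConePoint_iff]
    simpa [squarePoint, anchor] using hi
  · rw [isConePoint_iff]
    simpa [squarePoint, anchor] using hr
  · intro s hs
    rw [isConePoint_iff]
    simp [squarePoint, hs.1.le, hs.2.le, fold_eq_zero, hs.1.ne', hs.2.ne]

end Tiling

/-! ### Horizontal cylinder decompositions -/

section Cylinders

variable {α β : Type*}

/-- The points on the `r`-cycles of the marked points `a 0`, `a 1`, `a 2`. -/
def bottom (r : Perm α) (a : Fin 3 → α) : Set α := {b | ∃ i, ∃ x : ℕ, b = (r ^ x) (a i)}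

/-- The horizontal cylinder decomposition of a square-tiled surface with horizontal gluing `r` and
vertical gluing `u` whose vertex permutation is the 3-cycle `(a 0 a 1 a 2)`. The square `a i` has
the cone point as its lower left corner; the saddle connection leaving this corner to the right has
length `L i` and ends at the lower left corner of `a (π i)`; going up from `a i`, the next row of
squares with a cone point on its lower boundary is reached after `H i` steps. -/
structure Cylinders (r u : Perm α) (a : Fin 3 → α) (L : Fin 3 → ℕ) (π : Fin 3 → Fin 3)
    (H : Fin 3 → ℕ) : Prop where
  inj : Function.Injective a
  L_pos : ∀ i, 0 < L i
  ne_of_lt : ∀ i x, 0 < x → x < L i → ∀ j, (r ^ x) (a i) ≠ a j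
  ret : ∀ i, (r ^ L i) (a i) = a (π i)
  comm : ∀ y, (∀ j, r (u y) ≠ a j) → u (r y) = r (u y)
  turn : ∀ y j, r (u y) = a j → u (r y) = a (j - 1)
  H_pos : ∀ i, 0 < H i
  notMem_of_lt : ∀ i k, 0 < k → k < H i → (u ^ k) (a i) ∉ bottom r a
  mem_bottom : ∀ i, (u ^ H i) (a i) ∈ bottom r a
  eq_univ : ∀ s : Set α, s.Nonempty → (∀ y ∈ s, r y ∈ s) → (∀ y ∈ s, u y ∈ s) → s = Set.univ

/-- The horizontal gluing seen from above the row: the right neighbour of `y` among the squares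
above the row below `y`. -/
def topRight (r u : Perm α) : Perm α := u * r * u⁻¹

lemma perm_apply_pow (v : Perm α) (k : ℕ) (y : α) : v ((v ^ k) y) = (v ^ (k + 1)) y := by
  rw [pow_succ', Perm.mul_apply]

lemma up_right_pow (r u : Perm α) (x : ℕ) (y : α) :
    u ((r ^ x) y) = (topRight r u ^ x) (u y) := by
  rw [topRight, conj_pow]; simp [Perm.mul_apply]

lemma pow_right_mem_bottom {r : Perm α} {a : Fin 3 → α} {b : α} (hb : b ∈ bottom r a) (x : ℕ) :
    (r ^ x) b ∈ bottom r a := by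
  obtain ⟨i, y, rfl⟩ := hb
  exact ⟨i, x + y, by rw [pow_add, Perm.mul_apply]⟩

lemma marked_mem_bottom (r : Perm α) (a : Fin 3 → α) (i : Fin 3) : a i ∈ bottom r a :=
  ⟨i, 0, by simp⟩

lemma mem_bottom_of_right [Finite α] {r : Perm α} {a : Fin 3 → α} {b : α}
    (hb : r b ∈ bottom r a) : b ∈ bottom r a := by
  have h := pow_right_mem_bottom hb (orderOf r - 1)
  rwa [← Perm.mul_apply, pow_sub_one_mul (orderOf_pos r).ne', pow_orderOf_eq_one,
    Perm.one_apply] at h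

lemma mem_bottom_of_pow_right [Finite α] {r : Perm α} {a : Fin 3 → α} {b : α} {x : ℕ}
    (hb : (r ^ x) b ∈ bottom r a) : b ∈ bottom r a := by
  induction x with
  | zero => simpa using hb
  | succ x ih =>
    rw [pow_succ', Perm.mul_apply] at hb
    exact ih (mem_bottom_of_right hb)

namespace Cylinders

variable {r u : Perm α} {a : Fin 3 → α} {L : Fin 3 → ℕ} {π : Fin 3 → Fin 3} {H : Fin 3 → ℕ}
  (C : Cylinders r u a L π H)

include C

/-- The saddle connections are disjoint: a square on a bottom row lies on a single one of them, at a
single position. -/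
lemma segment_inj {i j : Fin 3} {x y : ℕ} (hx : x < L i) (hy : y < L j)
    (h : (r ^ x) (a i) = (r ^ y) (a j)) : i = j ∧ x = y := by
  have aux : ∀ {i j : Fin 3} {x y : ℕ}, x ≤ y → y < L j → (r ^ x) (a i) = (r ^ y) (a j) →
      i = j ∧ x = y := by
    intro i j x y hxy hy h
    obtain ⟨d, rfl⟩ := Nat.exists_eq_add_of_le hxy
    rw [pow_add, Perm.mul_apply, EmbeddingLike.apply_eq_iff_eq] at h
    rcases Nat.eq_zero_or_pos d with rfl | hd
    · exact ⟨C.inj (by simpa using h), rfl⟩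
    · exact absurd h.symm (C.ne_of_lt j d hd (by omega) i)
  rcases le_total x y with hxy | hxy
  · exact aux hxy hy h
  · obtain ⟨h1, h2⟩ := aux hxy hx h.symm
    exact ⟨h1.symm, h2.symm⟩

lemma right_segment_last {i : Fin 3} {x : ℕ} (h : x + 1 = L i) : r ((r ^ x) (a i)) = a (π i) := by
  rw [← Perm.mul_apply, ← pow_succ', h, C.ret]

lemma topRight_of_ne {y : α} (h : ∀ j, r y ≠ a j) : topRight r u y = r y := by
  obtain ⟨z, rfl⟩ := u.surjective y
  simpa [topRight, Perm.mul_apply] using C.comm z h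

lemma topRight_of_eq {y : α} {j : Fin 3} (h : r y = a j) : topRight r u y = a (j - 1) := by
  obtain ⟨z, rfl⟩ := u.surjective y
  simpa [topRight, Perm.mul_apply] using C.turn z j h

lemma topRight_segment {i : Fin 3} {x : ℕ} (h : x + 1 < L i) :
    topRight r u ((r ^ x) (a i)) = (r ^ (x + 1)) (a i) := by
  rw [pow_succ', Perm.mul_apply]
  refine C.topRight_of_ne fun j => ?_
  rw [← Perm.mul_apply, ← pow_succ']
  exact C.ne_of_lt i _ (by omega) h j

lemma topRight_segment_last {i : Fin 3} {x : ℕ} (h : x + 1 = L i) :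
    topRight r u ((r ^ x) (a i)) = a (π i - 1) :=
  C.topRight_of_eq (C.right_segment_last h)

lemma topRight_pow_segment {i : Fin 3} {x : ℕ} (h : x < L i) :
    (topRight r u ^ x) (a i) = (r ^ x) (a i) := by
  induction x with
  | zero => simp
  | succ x ih => rw [pow_succ', Perm.mul_apply, ih (by omega), C.topRight_segment h]

lemma topRight_ret (i : Fin 3) : (topRight r u ^ L i) (a i) = a (π i - 1) := by
  obtain ⟨x, hx⟩ := Nat.exists_eq_succ_of_ne_zero (C.L_pos i).ne'
  rw [hx, pow_succ', Perm.mul_apply, C.topRight_pow_segment (by omega),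
    C.topRight_segment_last (by omega)]

lemma exists_segment {b : α} (hb : b ∈ bottom r a) : ∃ i x, x < L i ∧ b = (r ^ x) (a i) := by
  obtain ⟨i, x, rfl⟩ := hb
  induction x with
  | zero => exact ⟨i, 0, C.L_pos i, rfl⟩
  | succ x ih =>
    obtain ⟨j, y, hy, h⟩ := ih
    rw [pow_succ', Perm.mul_apply, h]
    rcases (Nat.succ_le_of_lt hy).eq_or_lt with h1 | h1
    · exact ⟨π j, 0, C.L_pos _, by simpa using C.right_segment_last h1⟩
    · exact ⟨j, y + 1, h1, by rw [pow_succ', Perm.mul_apply]⟩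

lemma topRight_mem_bottom {b : α} (hb : b ∈ bottom r a) : topRight r u b ∈ bottom r a := by
  obtain ⟨j, y, hy, rfl⟩ := C.exists_segment hb
  rcases (Nat.succ_le_of_lt hy).eq_or_lt with h1 | h1
  · rw [C.topRight_segment_last h1]; exact marked_mem_bottom _ _ _
  · rw [C.topRight_segment h1]; exact ⟨_, _, rfl⟩

lemma topRight_pow_mem_bottom {b : α} (hb : b ∈ bottom r a) (x : ℕ) :
    (topRight r u ^ x) b ∈ bottom r a := by
  induction x with
  | zero => simpa using hb
  | succ x ih => rw [pow_succ', Perm.mul_apply]; exact C.topRight_mem_bottom ih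

variable [Finite α]

lemma up_right_pow_of_notMem {y : α} (h : u y ∉ bottom r a) (x : ℕ) :
    u ((r ^ x) y) = (r ^ x) (u y) := by
  induction x with
  | zero => simp
  | succ x ih =>
    have hx : (r ^ (x + 1)) (u y) ∉ bottom r a := fun hx => h (mem_bottom_of_pow_right hx)
    rw [pow_succ', Perm.mul_apply, Perm.mul_apply, ← ih]
    refine C.comm _ fun j hj => hx ?_
    rw [pow_succ', Perm.mul_apply, ← ih, hj]
    exact marked_mem_bottom _ _ _

/-- Below the next bottom row the gluings commute, so that whole rows move up by translation. -/
lemma climb {i : Fin 3} {k : ℕ} (hk : k < H i) (x : ℕ) :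
    (u ^ k) ((r ^ x) (a i)) = (r ^ x) ((u ^ k) (a i)) := by
  induction k with
  | zero => simp
  | succ k ih =>
    rw [pow_succ', Perm.mul_apply, ih (by omega), Perm.mul_apply]
    refine C.up_right_pow_of_notMem ?_ x
    rw [← Perm.mul_apply, ← pow_succ']
    exact C.notMem_of_lt i _ (by omega) hk

lemma climb_notMem {i : Fin 3} {k : ℕ} (h0 : 0 < k) (hk : k < H i) (x : ℕ) :
    (u ^ k) ((r ^ x) (a i)) ∉ bottom r a := by
  rw [C.climb hk]
  exact fun h => C.notMem_of_lt i k h0 hk (mem_bottom_of_pow_right h)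

/-- The last step up maps the top row of a cylinder to a bottom row, where the right neighbour is
given by `topRight`. -/
lemma land (i : Fin 3) (x : ℕ) :
    (u ^ H i) ((r ^ x) (a i)) = (topRight r u ^ x) ((u ^ H i) (a i)) := by
  obtain ⟨k, hk⟩ := Nat.exists_eq_succ_of_ne_zero (C.H_pos i).ne'
  rw [hk, pow_succ', Perm.mul_apply, C.climb (by omega), up_right_pow, Perm.mul_apply]

lemma land_mem (i : Fin 3) (x : ℕ) : (u ^ H i) ((r ^ x) (a i)) ∈ bottom r a := by
  rw [C.land]
  exact C.topRight_pow_mem_bottom (C.mem_bottom i) x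

lemma height_le {i j : Fin 3} {x y : ℕ} (h : (r ^ x) (a i) = (r ^ y) (a j)) : H i ≤ H j := by
  by_contra hlt
  refine C.climb_notMem (C.H_pos j) (not_le.1 hlt) x ?_
  rw [h]
  exact C.land_mem j y

lemma H_next (i : Fin 3) : H (π i) = H i := by
  have h : (r ^ 0) (a (π i)) = (r ^ L i) (a i) := (C.ret i).symm
  exact le_antisymm (C.height_le h) (C.height_le h.symm)

lemma climb_inj {i j : Fin 3} {x y k l : ℕ} (hk : k < H i) (hl : l < H j)
    (h : (u ^ k) ((r ^ x) (a i)) = (u ^ l) ((r ^ y) (a j))) :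
    k = l ∧ (r ^ x) (a i) = (r ^ y) (a j) := by
  have aux : ∀ {i j : Fin 3} {x y k l : ℕ}, k ≤ l → l < H j →
      (u ^ k) ((r ^ x) (a i)) = (u ^ l) ((r ^ y) (a j)) →
      k = l ∧ (r ^ x) (a i) = (r ^ y) (a j) := by
    intro i j x y k l hkl hl h
    obtain ⟨d, rfl⟩ := Nat.exists_eq_add_of_le hkl
    rw [pow_add, Perm.mul_apply, EmbeddingLike.apply_eq_iff_eq] at h
    rcases Nat.eq_zero_or_pos d with rfl | hd
    · exact ⟨rfl, by simpa using h⟩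
    · exact absurd ⟨i, x, h.symm⟩ (C.climb_notMem hd (by omega) y)
  rcases le_total k l with hkl | hkl
  · exact aux hkl hl h
  · obtain ⟨h1, h2⟩ := aux hkl hk h.symm
    exact ⟨h1.symm, h2.symm⟩

lemma land_inj {i j : Fin 3} {x y : ℕ}
    (h : (u ^ H i) ((r ^ x) (a i)) = (u ^ H j) ((r ^ y) (a j))) :
    (r ^ x) (a i) = (r ^ y) (a j) := by
  obtain ⟨k, hk⟩ := Nat.exists_eq_succ_of_ne_zero (C.H_pos i).ne'
  obtain ⟨l, hl⟩ := Nat.exists_eq_succ_of_ne_zero (C.H_pos j).ne'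
  rw [hk, hl, pow_succ', pow_succ', Perm.mul_apply, Perm.mul_apply,
    EmbeddingLike.apply_eq_iff_eq] at h
  exact (C.climb_inj (by omega) (by omega) h).2

lemma exists_coordinates (b : α) :
    ∃ i x k, x < L i ∧ k < H i ∧ b = (u ^ k) ((r ^ x) (a i)) := by
  have hu := C.eq_univ {b | ∃ i, ∃ x k : ℕ, k < H i ∧ b = (u ^ k) ((r ^ x) (a i))}
    ⟨a 0, 0, 0, 0, C.H_pos 0, by simp⟩ (by
      rintro _ ⟨i, x, k, hk, rfl⟩
      refine ⟨i, x + 1, k, hk, ?_⟩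
      rw [C.climb hk, C.climb hk, ← Perm.mul_apply, ← pow_succ']) (by
      rintro _ ⟨i, x, k, hk, rfl⟩
      rcases (Nat.succ_le_of_lt hk).eq_or_lt with h | h
      · obtain ⟨j, y, hj⟩ := C.land_mem i x
        refine ⟨j, y, 0, C.H_pos j, ?_⟩
        rw [← Perm.mul_apply, ← pow_succ', ← Nat.succ_eq_add_one, h, hj]
        simp
      · exact ⟨i, x, k + 1, h, by rw [← Perm.mul_apply, ← pow_succ']⟩)
  obtain ⟨i, x, k, hk, rfl⟩ : b ∈ {b | ∃ i, ∃ x k : ℕ, k < H i ∧ b = (u ^ k) ((r ^ x) (a i))} :=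
    hu ▸ Set.mem_univ b
  obtain ⟨j, y, hy, h⟩ := C.exists_segment ⟨i, x, rfl⟩
  exact ⟨j, y, k, hy, hk.trans_le (C.height_le h), by rw [h]⟩

lemma exists_land {b : α} (hb : b ∈ bottom r a) :
    ∃ i x, x < L i ∧ b = (u ^ H i) ((r ^ x) (a i)) := by
  obtain ⟨c, rfl⟩ := u.surjective b
  obtain ⟨i, x, k, hx, hk, rfl⟩ := C.exists_coordinates c
  rw [← Perm.mul_apply, ← pow_succ'] at hb ⊢
  refine ⟨i, x, hx, ?_⟩
  rcases (Nat.succ_le_of_lt hk).eq_or_lt with h | h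
  · rw [← h]
  · exact absurd hb (C.climb_notMem (Nat.succ_pos k) h x)

/-- Every square has unique coordinates: a saddle connection `i`, a position `x` along it, and a
height `k` above it. -/
lemma bijective_coordinates : Function.Bijective
    fun p : Σ i : Fin 3, Fin (L i) × Fin (H i) =>
      (u ^ (p.2.2 : ℕ)) ((r ^ (p.2.1 : ℕ)) (a p.1)) := by
  constructor
  · rintro ⟨i, x, k⟩ ⟨j, y, l⟩ h
    obtain ⟨h1, h2⟩ := C.climb_inj k.2 l.2 h
    obtain ⟨rfl, h3⟩ := C.segment_inj x.2 y.2 h2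
    obtain rfl := Fin.ext h3
    obtain rfl := Fin.ext h1
    rfl
  · intro b
    obtain ⟨i, x, k, hx, hk, rfl⟩ := C.exists_coordinates b
    exact ⟨⟨i, ⟨x, hx⟩, ⟨k, hk⟩⟩, rfl⟩

lemma card_eq : Nat.card α = L 0 * H 0 + L 1 * H 1 + L 2 * H 2 := by
  rw [← Nat.card_eq_of_bijective _ C.bijective_coordinates, Nat.card_eq_fintype_card,
    Fintype.card_sigma, Fin.sum_univ_three]
  simp

omit [Finite α] in
/-- The marked points may be relabelled cyclically, since the vertex permutation is a 3-cycle. -/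
lemma rotate (d : Fin 3) : Cylinders r u (fun i => a (i + d)) (fun i => L (i + d))
    (fun i => π (i + d) - d) (fun i => H (i + d)) := by
  have hb : bottom r (fun i => a (i + d)) = bottom r a := by
    ext b
    refine ⟨fun ⟨i, x, h⟩ => ⟨i + d, x, h⟩, fun ⟨i, x, h⟩ => ⟨i - d, x, ?_⟩⟩
    simpa using h
  constructor
  · exact fun i j h => by simpa using C.inj h
  · exact fun i => C.L_pos _
  · exact fun i x h h' j => C.ne_of_lt _ x h h' _
  · exact fun i => by simpa using C.ret _
  · exact fun y h => C.comm y fun j => by simpa using h (j - d)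
  · exact fun y j h => by
      rw [C.turn y _ h]
      exact congrArg a (sub_add_eq_add_sub _ _ _).symm
  · exact fun i => C.H_pos _
  · exact fun i k h h' => hb ▸ C.notMem_of_lt _ k h h'
  · exact fun i => hb ▸ C.mem_bottom _
  · exact C.eq_univ

end Cylinders

/-- `s` and `t` have the same position along the same saddle connection. -/
def Aligned (r : Perm α) (a : Fin 3 → α) (r' : Perm β) (b : Fin 3 → β) (L : Fin 3 → ℕ)
    (s : α) (t : β) : Prop :=
  ∃ i x, x < L i ∧ s = (r ^ x) (a i) ∧ t = (r' ^ x) (b i)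

section Isomorphism

variable {r u : Perm α} {a : Fin 3 → α} {r' u' : Perm β} {b : Fin 3 → β} {L : Fin 3 → ℕ}
  {π : Fin 3 → Fin 3} {H : Fin 3 → ℕ}

lemma Cylinders.aligned (C : Cylinders r u a L π H) (i : Fin 3) :
    Aligned r a r' b L (a i) (b i) := ⟨i, 0, C.L_pos i, rfl, rfl⟩

lemma Aligned.right_pow {s : α} {t : β} (h : Aligned r a r' b L s t) (C : Cylinders r u a L π H)
    (D : Cylinders r' u' b L π H) (z : ℕ) : Aligned r a r' b L ((r ^ z) s) ((r' ^ z) t) := by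
  induction z with
  | zero => simpa using h
  | succ z ih =>
    obtain ⟨i, x, hx, hs, ht⟩ := ih
    rw [pow_succ', Perm.mul_apply, pow_succ', Perm.mul_apply, hs, ht]
    rcases (Nat.succ_le_of_lt hx).eq_or_lt with h | h
    · rw [C.right_segment_last h, D.right_segment_last h]
      exact C.aligned _
    · exact ⟨i, x + 1, h, by rw [pow_succ', Perm.mul_apply], by rw [pow_succ', Perm.mul_apply]⟩

lemma Aligned.topRight_pow {s : α} {t : β} (h : Aligned r a r' b L s t)
    (C : Cylinders r u a L π H) (D : Cylinders r' u' b L π H) (z : ℕ) :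
    Aligned r a r' b L ((topRight r u ^ z) s) ((topRight r' u' ^ z) t) := by
  induction z with
  | zero => simpa using h
  | succ z ih =>
    obtain ⟨i, x, hx, hs, ht⟩ := ih
    rw [pow_succ', Perm.mul_apply, pow_succ', Perm.mul_apply, hs, ht]
    rcases (Nat.succ_le_of_lt hx).eq_or_lt with h | h
    · rw [C.topRight_segment_last h, D.topRight_segment_last h]
      exact C.aligned _
    · rw [C.topRight_segment h, D.topRight_segment h]
      exact ⟨i, x + 1, h, rfl, rfl⟩

variable [Finite α] [Finite β]

/-- The twist of a cylinder is determined by where any one of the marked points at its bottom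
lands. -/
lemma Cylinders.aligned_next (C : Cylinders r u a L π H) (D : Cylinders r' u' b L π H) {i : Fin 3}
    (h : Aligned r a r' b L ((u ^ H i) (a i)) ((u' ^ H i) (b i))) :
    Aligned r a r' b L ((u ^ H (π i)) (a (π i))) ((u' ^ H (π i)) (b (π i))) := by
  rw [C.H_next, ← C.ret, ← D.ret, C.land, D.land]
  exact h.topRight_pow C D _

/-- The cylinder decomposition together with the twists determines the surface. -/
theorem Cylinders.exists_equiv (C : Cylinders r u a L π H) (D : Cylinders r' u' b L π H)
    (h : ∀ i, Aligned r a r' b L ((u ^ H i) (a i)) ((u' ^ H i) (b i))) :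
    ∃ e : α ≃ β, ∀ y, e (r y) = r' (e y) ∧ e (u y) = u' (e y) := by
  let E := (Equiv.ofBijective _ C.bijective_coordinates).symm.trans
    (Equiv.ofBijective _ D.bijective_coordinates)
  have hE {i : Fin 3} {x k : ℕ} (hx : x < L i) (hk : k < H i) :
      E ((u ^ k) ((r ^ x) (a i))) = (u' ^ k) ((r' ^ x) (b i)) := by
    have := Equiv.ofBijective_symm_apply_apply _ C.bijective_coordinates ⟨i, ⟨x, hx⟩, ⟨k, hk⟩⟩
    simp only at this
    simp only [E, Equiv.trans_apply, this, Equiv.ofBijective_apply]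
  have hal {s : α} {t : β} (h : Aligned r a r' b L s t) : E s = t := by
    obtain ⟨i, x, hx, rfl, rfl⟩ := h
    exact hE hx (C.H_pos i) (k := 0)
  have hk' {s : α} {t : β} {i : Fin 3} {x k : ℕ} (hk : k < H i)
      (hs : s = (u ^ k) ((r ^ x) (a i))) (ht : t = (u' ^ k) ((r' ^ x) (b i))) : E s = t := by
    obtain ⟨j, y, hy, h1, h2⟩ := (C.aligned (r' := r') (b := b) i).right_pow C D x
    rw [hs, ht, h1, h2, hE hy (hk.trans_le (C.height_le h1))]
  refine ⟨E, fun y => ?_⟩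
  obtain ⟨i, x, k, hx, hk, rfl⟩ := C.exists_coordinates y
  rw [hE hx hk]
  constructor
  · refine hk' hk (x := x + 1) ?_ ?_
    · rw [C.climb hk, C.climb hk, ← Perm.mul_apply, ← pow_succ']
    · rw [D.climb hk, D.climb hk, ← Perm.mul_apply, ← pow_succ']
  · rw [perm_apply_pow, perm_apply_pow]
    rcases (Nat.succ_le_of_lt hk).eq_or_lt with h1 | h1
    · rw [← Nat.succ_eq_add_one, h1, C.land, D.land]
      exact hal ((h i).topRight_pow C D x)
    · exact hE hx h1

end Isomorphism

end Cylinders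

/-! ### The two types of cylinder decompositions -/

namespace Tiling

variable {n : ℕ} (S : Tiling n)

open scoped Pointwise in
/-- The stratum condition labels the corners of the squares at the cone point by a 3-cycle; lengths
and heights are first return times to these squares and to their rows. -/
theorem exists_cylinders (h : S.vertexPerm.support.card = 3) :
    ∃ a L π H, Cylinders S.right S.up a L π H ∧ ∀ x ∈ S.vertexPerm.support, ∃ i, x = a i := by
  classical
  have h3 := card_support_eq_three_iff.1 h
  have ho : S.vertexPerm ^ 3 = 1 := h3.orderOf ▸ pow_orderOf_eq_one _
  obtain ⟨c, hc⟩ : S.vertexPerm.support.Nonempty := Finset.card_pos.1 (by omega)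
  rw [Perm.mem_support] at hc
  have e3 : S.vertexPerm (S.vertexPerm (S.vertexPerm c)) = c := by
    have := congrArg (fun p : Perm (Fin n) => p c) ho
    simpa [pow_succ, Perm.mul_apply] using this
  set g := S.vertexPerm with hg
  have hc2 : g (g c) ≠ c := by
    intro e
    rw [e] at e3
    exact hc e3
  let a : Fin 3 → Fin n := ![c, g c, g (g c)]
  have hga (i : Fin 3) : g (a i) = a (i + 1) := by
    fin_cases i
    · rfl
    · rfl
    · exact e3
  have hinj : Function.Injective a := by
    intro i j hij
    have hc1 : g (g c) ≠ g c := fun e => hc (g.injective e)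
    fin_cases i <;> fin_cases j <;> first
      | rfl
      | exact absurd hij hc
      | exact absurd hij hc.symm
      | exact absurd hij hc1
      | exact absurd hij hc1.symm
      | exact absurd hij hc2
      | exact absurd hij hc2.symm
  have hsupp : g.support = Finset.univ.image a := by
    symm
    apply Finset.eq_of_subset_of_card_le
    · intro x hx
      obtain ⟨i, -, rfl⟩ := Finset.mem_image.1 hx
      rw [Perm.mem_support, hga]
      exact fun e => by simpa using hinj e
    · rw [Finset.card_image_of_injective _ hinj, h]
      simp
  have hfix (y : Fin n) (hy : ∀ j, y ≠ a j) : g y = y := by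
    rw [← Perm.notMem_support, hsupp]
    simp only [Finset.mem_image, not_exists, not_and]
    exact fun j _ e => hy j e.symm
  have hret (i : Fin 3) : ∃ x, 0 < x ∧ ∃ j, (S.right ^ x) (a i) = a j :=
    ⟨orderOf S.right, orderOf_pos _, i, by rw [pow_orderOf_eq_one]; rfl⟩
  have hup (i : Fin 3) : ∃ k, 0 < k ∧ (S.up ^ k) (a i) ∈ bottom S.right a :=
    ⟨orderOf S.up, orderOf_pos _, by
      rw [pow_orderOf_eq_one]; exact marked_mem_bottom _ _ _⟩
  refine ⟨a, fun i => Nat.find (hret i), fun i => (Nat.find_spec (hret i)).2.choose,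
    fun i => Nat.find (hup i), ⟨hinj, fun i => (Nat.find_spec (hret i)).1, ?_,
      fun i => (Nat.find_spec (hret i)).2.choose_spec, ?_, ?_,
      fun i => (Nat.find_spec (hup i)).1, ?_, fun i => (Nat.find_spec (hup i)).2, ?_⟩, ?_⟩
  · exact fun i x h0 hx j e => Nat.find_min (hret i) hx ⟨h0, j, e⟩
  · intro y hy
    rw [← S.vertexPerm_up_right] at hy ⊢
    by_contra hne
    have hm : S.up (S.right y) ∈ g.support := Perm.mem_support.2 (Ne.symm hne)
    rw [← Perm.apply_mem_support, hsupp] at hm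
    obtain ⟨j, -, hj⟩ := Finset.mem_image.1 hm
    exact hy j hj.symm
  · intro y j hy
    rw [← S.vertexPerm_up_right] at hy
    apply g.injective
    rw [hy, hga, sub_add_cancel]
  · exact fun i k h0 hk e => Nat.find_min (hup i) hk ⟨h0, e⟩
  · intro s hs hr hu
    have hmem (p : Perm (Fin n)) (hp : ∀ y ∈ s, p y ∈ s) :
        p ∈ MulAction.stabilizer (Perm (Fin n)) s := by
      rw [MulAction.mem_stabilizer_iff]
      have hsub : p • s ⊆ s := by
        rintro _ ⟨y, hy, rfl⟩
        exact hp y hy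
      refine Set.eq_of_subset_of_ncard_le hsub ?_ s.toFinite
      exact (Set.ncard_image_of_injective s p.injective).ge
    have hle : Subgroup.closure {S.right, S.up} ≤ MulAction.stabilizer (Perm (Fin n)) s := by
      rw [Subgroup.closure_le]
      rintro p (rfl | rfl)
      · exact hmem _ hr
      · exact hmem _ hu
    obtain ⟨y, hy⟩ := hs
    refine Set.eq_univ_of_forall fun z => ?_
    have := S.connected
    obtain ⟨⟨p, hp⟩, rfl⟩ := MulAction.exists_smul_eq (Subgroup.closure {S.right, S.up}) y z
    have hps := MulAction.mem_stabilizer_iff.1 (hle hp)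
    rw [← hps]
    exact ⟨y, hy, rfl⟩
  · intro x hx
    rw [hsupp] at hx
    obtain ⟨i, -, rfl⟩ := Finset.mem_image.1 hx
    exact ⟨i, rfl⟩

end Tiling

section Classification

variable {α : Type*} {r u : Perm α} {a : Fin 3 → α} {L : Fin 3 → ℕ} {π : Fin 3 → Fin 3}
  {H : Fin 3 → ℕ}

namespace Cylinders

variable (C : Cylinders r u a L π H)

include C

lemma exists_pow_right (T : Set (Fin 3)) (hT : ∀ i ∈ T, π i ∈ T) {i : Fin 3} (hi : i ∈ T) (z : ℕ) :
    ∃ j ∈ T, ∃ y, y < L j ∧ (r ^ z) (a i) = (r ^ y) (a j) := by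
  induction z with
  | zero => exact ⟨i, hi, 0, C.L_pos i, rfl⟩
  | succ z ih =>
    obtain ⟨j, hj, y, hy, h⟩ := ih
    rw [← perm_apply_pow, h]
    rcases (Nat.succ_le_of_lt hy).eq_or_lt with h1 | h1
    · exact ⟨π j, hT j hj, 0, C.L_pos _, by simpa using C.right_segment_last h1⟩
    · exact ⟨j, hj, y + 1, h1, perm_apply_pow _ _ _⟩

lemma exists_pow_topRight (T : Set (Fin 3)) (hT : ∀ i ∈ T, π i - 1 ∈ T) {i : Fin 3} (hi : i ∈ T)
    {x : ℕ} (hx : x < L i) (z : ℕ) :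
    ∃ j ∈ T, ∃ y, y < L j ∧ (topRight r u ^ z) ((r ^ x) (a i)) = (r ^ y) (a j) := by
  induction z with
  | zero => exact ⟨i, hi, x, hx, rfl⟩
  | succ z ih =>
    obtain ⟨j, hj, y, hy, h⟩ := ih
    rw [← perm_apply_pow, h]
    rcases (Nat.succ_le_of_lt hy).eq_or_lt with h1 | h1
    · exact ⟨_, hT j hj, 0, C.L_pos _, by simpa using C.topRight_segment_last h1⟩
    · exact ⟨j, hj, y + 1, h1, C.topRight_segment h1⟩

lemma sameCycle_right (i : Fin 3) : r.SameCycle (a i) (a (π i)) := by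
  rw [← C.ret i, Perm.sameCycle_pow_right]

lemma sameCycle_topRight (i : Fin 3) : (topRight r u).SameCycle (a i) (a (π i - 1)) := by
  rw [← C.topRight_ret i, Perm.sameCycle_pow_right]

variable [Finite α]

lemma sameCycle_land {i j : Fin 3} (h : r.SameCycle (a i) (a j)) :
    (topRight r u).SameCycle ((u ^ H i) (a i)) ((u ^ H j) (a j)) := by
  obtain ⟨x, hx⟩ := h.exists_nat_pow_eq
  have hH : H i = H j := le_antisymm (C.height_le (x := x) (y := 0) hx)
    (C.height_le (x := 0) (y := x) hx.symm)
  rw [← hx, ← hH, C.land, Perm.sameCycle_pow_right]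

lemma sameCycle_of_land {i j : Fin 3}
    (h : (topRight r u).SameCycle ((u ^ H i) (a i)) ((u ^ H j) (a j))) :
    r.SameCycle (a i) (a j) := by
  obtain ⟨x, hx⟩ := h.exists_nat_pow_eq
  rw [← C.land] at hx
  have := C.land_inj (y := 0) hx
  rw [pow_zero, Perm.one_apply] at this
  rw [← this, Perm.sameCycle_pow_right]

/-- The three saddle connections do not bound three different rows from below: from above they would
bound a single one. -/
lemma not_forall_next_eq_self (h : ∀ i, π i = i) : False := by
  have s2 (i : Fin 3) : (topRight r u).SameCycle (a i) (a (i - 1)) := by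
    simpa [h] using C.sameCycle_topRight i
  have s0 (i : Fin 3) : (topRight r u).SameCycle (a 0) (a i) := by
    fin_cases i
    · exact .refl _ _
    · exact (s2 0).trans (s2 2)
    · exact s2 0
  have sb {b : α} (hb : b ∈ bottom r a) : (topRight r u).SameCycle (a 0) b := by
    obtain ⟨i, x, hx, rfl⟩ := C.exists_segment hb
    rw [← C.topRight_pow_segment hx, Perm.sameCycle_pow_right]
    exact s0 i
  obtain ⟨x, hx⟩ := (C.sameCycle_of_land ((sb (C.mem_bottom 0)).symm.trans
    (sb (C.mem_bottom 1)))).exists_nat_pow_eq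
  obtain ⟨j, hj, y, hy, e⟩ := C.exists_pow_right {0} (by simp [h]) (i := 0) rfl x
  obtain rfl : j = 0 := hj
  exact absurd (C.segment_inj (x := 0) (C.L_pos 1) hy (hx.symm.trans e)).1 (by decide)

/-- The saddle connections do not follow each other along a single row in the order in which they
follow each other around the cone point: from above they would bound three different rows. -/
lemma not_forall_next_eq_add_one (h : ∀ i, π i = i + 1) : False := by
  obtain ⟨j, x, hx, e⟩ := C.exists_segment (C.mem_bottom 0)
  have s1 (i : Fin 3) : r.SameCycle (a i) (a (i + 1)) := by simpa [h] using C.sameCycle_right i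
  have s0 (i : Fin 3) : r.SameCycle (a 0) (a i) := by
    fin_cases i
    · exact .refl _ _
    · exact s1 0
    · exact (s1 0).trans (s1 1)
  obtain ⟨i, y, hy, e'⟩ := C.exists_land (marked_mem_bottom r a (j + 1))
  have : (topRight r u).SameCycle ((r ^ x) (a j)) (a (j + 1)) := by
    rw [← e, e', C.land, Perm.sameCycle_pow_right]
    exact C.sameCycle_land (s0 i)
  obtain ⟨z, hz⟩ := this.exists_nat_pow_eq
  obtain ⟨k, hk, y', hy', e2⟩ := C.exists_pow_topRight {j} (by simp [h]) (i := j) rfl hx z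
  obtain rfl : k = j := hk
  simpa using (C.segment_inj (x := 0) (C.L_pos (k + 1)) hy' (hz.symm.trans e2)).1

/-- Either there is a single row with cone points at its bottom, or there are two, one of them with
a single saddle connection. -/
lemma next_cases : (∀ i, π i = i + 2) ∨ ∃ d, π d = d ∧ π (d + 1) = d + 2 ∧ π (d + 2) = d + 1 := by
  have hinj : Function.Injective π := by
    intro i j hij
    have h := (C.ret i).trans ((congrArg a hij).trans (C.ret j).symm)
    obtain ⟨x, hx⟩ := Nat.exists_eq_succ_of_ne_zero (C.L_pos i).ne'
    obtain ⟨y, hy⟩ := Nat.exists_eq_succ_of_ne_zero (C.L_pos j).ne'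
    rw [hx, hy, ← Nat.add_one, ← Nat.add_one, ← perm_apply_pow, ← perm_apply_pow,
      EmbeddingLike.apply_eq_iff_eq] at h
    exact (C.segment_inj (by omega) (by omega) h).1
  have key : ∀ f : Fin 3 → Fin 3, Function.Injective f → (∀ i, f i = i) ∨ (∀ i, f i = i + 1) ∨
      (∀ i, f i = i + 2) ∨ ∃ d, f d = d ∧ f (d + 1) = d + 2 ∧ f (d + 2) = d + 1 := by decide
  rcases key π hinj with h | h | h | h
  · exact (C.not_forall_next_eq_self h).elim
  · exact (C.not_forall_next_eq_add_one h).elim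
  · exact Or.inl h
  · exact Or.inr h

omit [Finite α] in
lemma exists_twist_of_one_row (h : ∀ i, π i = i + 2) :
    ∃ t < L 0 + L 1 + L 2, (u ^ H 0) (a 0) = (r ^ t) (a 0) := by
  have h2 : (r ^ L 0) (a 0) = a 2 := by rw [C.ret, h]; rfl
  have h1 : (r ^ L 2) (a 2) = a 1 := by rw [C.ret, h]; rfl
  obtain ⟨j, y, hy, e⟩ := C.exists_segment (C.mem_bottom 0)
  rw [e]
  fin_cases j
  · exact ⟨y, by simp at hy; omega, rfl⟩
  · exact ⟨y + (L 2 + L 0), by simp at hy; omega, by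
      rw [pow_add, pow_add, Perm.mul_apply, Perm.mul_apply, h2, h1]; rfl⟩
  · exact ⟨y + L 0, by simp at hy; omega, by rw [pow_add, Perm.mul_apply, h2]; rfl⟩

/-- If there are two rows, then the saddle connection `0` alone bounds one of them from below, and
the saddle connection `1` alone bounds it from above. -/
lemma exists_twists_of_two_rows (h0 : π 0 = 0) (h1 : π 1 = 2) (h2 : π 2 = 1) :
    L 0 = L 1 ∧ (∃ t < L 1, (u ^ H 0) (a 0) = (r ^ t) (a 1)) ∧
      ∃ t < L 0 + L 2, (u ^ H 1) (a 1) = (topRight r u ^ t) (a 0) := by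
  have hne : a 1 ≠ a 2 := fun e => absurd (C.inj e) (by decide)
  have hT1 : ∀ i ∈ ({1} : Set (Fin 3)), π i - 1 ∈ ({1} : Set (Fin 3)) := by
    rintro i rfl
    rw [h1]; rfl
  have hT02 : ∀ i ∈ ({0, 2} : Set (Fin 3)), π i - 1 ∈ ({0, 2} : Set (Fin 3)) := by
    rintro i (rfl | rfl)
    · rw [h0]; exact Or.inr rfl
    · rw [h2]; exact Or.inl rfl
  have r0 : (r ^ L 0) (a 0) = a 0 := by rw [C.ret, h0]
  have r1 : (r ^ L 1) (a 1) = a 2 := by rw [C.ret, h1]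
  have q0 : (topRight r u ^ L 0) (a 0) = a 2 := by rw [C.topRight_ret, h0]; rfl
  have q1 : (topRight r u ^ L 1) (a 1) = a 1 := by rw [C.topRight_ret, h1]; rfl
  have s12 : r.SameCycle (a 1) (a 2) := h1 ▸ C.sameCycle_right 1
  have hland {b : α} (hb : b ∈ bottom r a) :
      (topRight r u).SameCycle ((u ^ H 0) (a 0)) b ∨
        (topRight r u).SameCycle ((u ^ H 1) (a 1)) b := by
    obtain ⟨i, x, hx, rfl⟩ := C.exists_land hb
    simp only [C.land, Perm.sameCycle_pow_right]
    fin_cases i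
    · exact Or.inl (.refl _ _)
    · exact Or.inr (.refl _ _)
    · exact Or.inr (C.sameCycle_land s12)
  -- saddle connections on one cycle of `topRight r u` cannot reach the others
  have sep (T : Set (Fin 3)) (hT : ∀ i ∈ T, π i - 1 ∈ T) {i j : Fin 3} {x : ℕ} (hi : i ∈ T)
      (hx : x < L i) (h : (topRight r u).SameCycle ((r ^ x) (a i)) (a j)) : j ∈ T := by
    obtain ⟨z, hz⟩ := h.exists_nat_pow_eq
    obtain ⟨k, hk, y, hy, e⟩ := C.exists_pow_topRight T hT hi hx z
    rwa [(C.segment_inj (x := 0) (C.L_pos j) hy (hz.symm.trans e)).1]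
  have comm (x y : ℕ) (b : α) : (topRight r u ^ x) ((topRight r u ^ y) b) =
      (topRight r u ^ y) ((topRight r u ^ x) b) := by
    rw [← Perm.mul_apply, ← Perm.mul_apply, ← pow_add, ← pow_add, add_comm]
  have notMem1 : (1 : Fin 3) ∉ ({0, 2} : Set (Fin 3)) := by
    rintro (h | h) <;> exact absurd h (by decide)
  -- if the row of `a 1` landed on the saddle connection `1`, its period `L 1 + L 2` would be `L 1`
  have land1 {x : ℕ} (hx : x < L 1) (e : (u ^ H 1) (a 1) = (r ^ x) (a 1)) : False := by
    have e1 := C.land 1 (L 1)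
    rw [e, ← C.topRight_pow_segment hx, comm, q1, C.topRight_pow_segment hx, ← e] at e1
    exact hne.symm (by simpa [r1] using C.land_inj (x := L 1) (y := 0) e1)
  obtain ⟨j, y, hy, e⟩ := C.exists_segment (C.mem_bottom 0)
  obtain ⟨k, z, hz, e'⟩ := C.exists_segment (C.mem_bottom 1)
  have hj : j = 1 := by
    by_contra hj
    have hj : j ∈ ({0, 2} : Set (Fin 3)) := by
      fin_cases j
      · exact Or.inl rfl
      · exact absurd rfl hj
      · exact Or.inr rfl
    rcases hland (marked_mem_bottom r a 1) with h | h
    · exact notMem1 (sep _ hT02 hj hy (e ▸ h))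
    · by_cases hk : k = 1
      · subst hk
        exact land1 hz e'
      · refine notMem1 (sep _ hT02 (i := k) (x := z) ?_ hz (e' ▸ h))
        fin_cases k
        · exact Or.inl rfl
        · exact absurd rfl hk
        · exact Or.inr rfl
  subst hj
  refine ⟨le_antisymm ?_ ?_, ⟨y, hy, e⟩, ?_⟩
  · by_contra hlt
    have e1 := C.land 0 (L 1)
    rw [e, ← C.topRight_pow_segment hy, comm, q1, C.topRight_pow_segment hy, ← e] at e1
    have := C.land_inj (x := L 1) (y := 0) e1
    exact C.ne_of_lt 0 (L 1) (C.L_pos 1) (not_le.1 hlt) 0 (by simpa using this)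
  · by_contra hlt
    have e1 := C.land 0 (L 0)
    rw [r0, e, ← C.topRight_pow_segment hy, comm, EmbeddingLike.apply_eq_iff_eq,
      C.topRight_pow_segment (not_le.1 hlt)] at e1
    exact C.ne_of_lt 1 (L 0) (C.L_pos 0) (not_le.1 hlt) 1 e1.symm
  · have hk : k ≠ 1 := by
      rintro rfl
      exact land1 hz e'
    rw [e', ← C.topRight_pow_segment hz]
    fin_cases k
    · exact ⟨z, by simp at hz; omega, rfl⟩
    · exact absurd rfl hk
    · exact ⟨z + L 0, by simp at hz; omega, by rw [pow_add, Perm.mul_apply, q0]; rfl⟩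

end Cylinders

/-- The surface has a single horizontal cylinder, of height `h`, with saddle connections of lengths
`l₀`, `l₁`, `l₂` on its boundary and with twist `t`. -/
def OneRow (r u : Perm α) (h l₀ l₁ l₂ t : ℕ) : Prop :=
  ∃ a, Cylinders r u a ![l₀, l₁, l₂] (fun i => i + 2) (fun _ => h) ∧
    (u ^ h) (a 0) = (r ^ t) (a 0)

/-- The surface has two horizontal cylinders: one of height `h₁`, circumference `w` and twist `t₁`,
and one of height `h₂`, circumference `w + l` and twist `t₂`. -/
def TwoRows (r u : Perm α) (h₁ h₂ w l t₁ t₂ : ℕ) : Prop :=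
  ∃ a, Cylinders r u a ![w, w, l] ![0, 2, 1] ![h₁, h₂, h₂] ∧
    (u ^ h₁) (a 0) = (r ^ t₁) (a 1) ∧ (u ^ h₂) (a 1) = (topRight r u ^ t₂) (a 0)

variable [Finite α]

lemma OneRow.card_eq {h l₀ l₁ l₂ t : ℕ} (hR : OneRow r u h l₀ l₁ l₂ t) :
    Nat.card α = (l₀ + l₁ + l₂) * h := by
  obtain ⟨a, C, -⟩ := hR
  simpa [add_mul] using C.card_eq

lemma TwoRows.card_eq {h₁ h₂ w l t₁ t₂ : ℕ} (hR : TwoRows r u h₁ h₂ w l t₁ t₂) :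
    Nat.card α = w * h₁ + (w + l) * h₂ := by
  obtain ⟨a, C, -⟩ := hR
  have := C.card_eq
  simp at this
  linarith

theorem OneRow.exists_equiv {β : Type*} [Finite β] {r' u' : Perm β} {h l₀ l₁ l₂ t : ℕ}
    (hR : OneRow r u h l₀ l₁ l₂ t) (hR' : OneRow r' u' h l₀ l₁ l₂ t) :
    ∃ e : α ≃ β, ∀ y, e (r y) = r' (e y) ∧ e (u y) = u' (e y) := by
  obtain ⟨a, C, ht⟩ := hR
  obtain ⟨b, D, ht'⟩ := hR'
  have h0 : Aligned r a r' b ![l₀, l₁, l₂] ((u ^ h) (a 0)) ((u' ^ h) (b 0)) := by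
    rw [ht, ht']
    exact (C.aligned 0).right_pow C D t
  have h2 := C.aligned_next D h0
  refine C.exists_equiv D fun i => ?_
  fin_cases i
  · exact h0
  · exact C.aligned_next D h2
  · exact h2

theorem TwoRows.exists_equiv {β : Type*} [Finite β] {r' u' : Perm β} {h₁ h₂ w l t₁ t₂ : ℕ}
    (hR : TwoRows r u h₁ h₂ w l t₁ t₂) (hR' : TwoRows r' u' h₁ h₂ w l t₁ t₂) :
    ∃ e : α ≃ β, ∀ y, e (r y) = r' (e y) ∧ e (u y) = u' (e y) := by
  obtain ⟨a, C, ht, hs⟩ := hR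
  obtain ⟨b, D, ht', hs'⟩ := hR'
  have a0 : Aligned r a r' b ![w, w, l] ((u ^ h₁) (a 0)) ((u' ^ h₁) (b 0)) := by
    rw [ht, ht']
    exact (C.aligned 1).right_pow C D t₁
  have a1 : Aligned r a r' b ![w, w, l] ((u ^ h₂) (a 1)) ((u' ^ h₂) (b 1)) := by
    rw [hs, hs']
    exact (C.aligned 0).topRight_pow C D t₂
  refine C.exists_equiv D fun i => ?_
  fin_cases i
  · exact a0
  · exact a1
  · exact C.aligned_next D (i := 1) a1

lemma Cylinders.oneRow (C : Cylinders r u a L π H) (h : ∀ i, π i = i + 2) :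
    ∃ t < L 0 + L 1 + L 2, OneRow r u (H 0) (L 0) (L 1) (L 2) t := by
  obtain ⟨t, ht, e⟩ := C.exists_twist_of_one_row h
  have h2 := C.H_next 0
  have h1 := C.H_next 2
  have eL : L = ![L 0, L 1, L 2] := by
    funext i; fin_cases i <;> rfl
  have eπ : π = fun i => i + 2 := funext h
  rw [h] at h1 h2
  have eH : H = fun _ => H 0 := by
    funext i
    fin_cases i
    · rfl
    · exact h1.trans h2
    · exact h2
  refine ⟨t, ht, a, ?_, e⟩
  rwa [← eL, ← eπ, ← eH]

lemma Cylinders.twoRows (C : Cylinders r u a L π H) (h0 : π 0 = 0) (h1 : π 1 = 2) (h2 : π 2 = 1) :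
    ∃ t₁ < L 0, ∃ t₂ < L 0 + L 2, L 1 = L 0 ∧ TwoRows r u (H 0) (H 1) (L 0) (L 2) t₁ t₂ := by
  obtain ⟨e0, ⟨t₁, ht₁, e1⟩, t₂, ht₂, e2⟩ := C.exists_twists_of_two_rows h0 h1 h2
  have eL : L = ![L 0, L 0, L 2] := by
    funext i; fin_cases i
    · rfl
    · exact e0.symm
    · rfl
  have eπ : π = ![0, 2, 1] := by
    funext i; fin_cases i
    · exact h0
    · exact h1
    · exact h2
  have eH : H = ![H 0, H 1, H 1] := by
    have h := C.H_next 1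
    rw [h1] at h
    funext i; fin_cases i
    · rfl
    · rfl
    · exact h
  refine ⟨t₁, e0 ▸ ht₁, t₂, ht₂, e0.symm, a, ?_, e1, e2⟩
  rwa [← eL, ← eπ, ← eH]

end Classification

/-! ### Counting surfaces by codes -/

open Finset

instance (n : ℕ) : Finite (Tiling n) :=
  Finite.of_injective (fun S => (S.right, S.up)) fun S T h => by
    cases S; cases T; simp_all

/-- The surfaces whose gluing permutations satisfy the condition `R` coded by some element of
`D`. -/
def codedSurfaces (n : ℕ) {ι : Type*} (R : Perm (Fin n) → Perm (Fin n) → ι → Prop) (D : Finset ι) :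
    Set (Quotient (Tiling.setoid n)) :=
  {X | ∃ S : Tiling n, ⟦S⟧ = X ∧ ∃ d ∈ D, R S.right S.up d}

lemma ncard_codedSurfaces_le {n : ℕ} {ι : Type*} {R : Perm (Fin n) → Perm (Fin n) → ι → Prop}
    (D : Finset ι) (hR : ∀ r u r' u' d, R r u d → R r' u' d →
      ∃ e : Perm (Fin n), ∀ y, e (r y) = r' (e y) ∧ e (u y) = u' (e y)) :
    (codedSurfaces n R D).ncard ≤ D.card := by
  choose f hf d hd hfd using fun X : codedSurfaces n R D => X.2
  rw [← Set.ncard_coe_finset D, ← Nat.card_coe_set_eq, ← Nat.card_coe_set_eq]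
  refine Nat.card_le_card_of_injective (fun X => (⟨d X, hd X⟩ : (D : Set ι))) fun X Y h => ?_
  have h : d X = d Y := congrArg Subtype.val h
  refine Subtype.ext ?_
  rw [← hf X, ← hf Y]
  exact Quotient.sound (hR _ _ _ _ (d X) (hfd X) (h ▸ hfd Y))

/-! ### Codes for surfaces with one or two horizontal cylinders -/

/-- One cylinder of height `h`, two of the saddle connections, and the twist; the third saddle
connection is determined by the number of squares. -/
def OneRowCode {n : ℕ} (r u : Perm (Fin n)) (d : Σ _ : ℕ, ℕ × ℕ × ℕ) : Prop :=
  0 < d.1 ∧ ∃ l₂, OneRow r u d.1 d.2.1 d.2.2.1 l₂ d.2.2.2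

/-- Two cylinders, coded by the height of the long one, the sum of both heights, the circumference
of the short one, and the twists; the circumference of the long one is determined by the number of
squares. -/
def TwoRowsCode {n : ℕ} (r u : Perm (Fin n)) (d : Σ _ : ℕ, Σ _ : ℕ, ℕ × ℕ × ℕ) : Prop :=
  0 < d.1 ∧ ∃ l, TwoRows r u (d.2.1 - d.1) d.1 d.2.2.1 l d.2.2.2.1 d.2.2.2.2

lemma OneRowCode.exists_equiv {n : ℕ} (r u r' u' : Perm (Fin n)) (d : Σ _ : ℕ, ℕ × ℕ × ℕ)
    (h : OneRowCode r u d) (h' : OneRowCode r' u' d) :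
    ∃ e : Perm (Fin n), ∀ y, e (r y) = r' (e y) ∧ e (u y) = u' (e y) := by
  obtain ⟨hd, l, hl⟩ := h
  obtain ⟨-, l', hl'⟩ := h'
  have := Nat.eq_of_mul_eq_mul_right hd (hl.card_eq.symm.trans hl'.card_eq)
  obtain rfl : l = l' := by omega
  exact hl.exists_equiv hl'

lemma TwoRowsCode.exists_equiv {n : ℕ} (r u r' u' : Perm (Fin n))
    (d : Σ _ : ℕ, Σ _ : ℕ, ℕ × ℕ × ℕ) (h : TwoRowsCode r u d) (h' : TwoRowsCode r' u' d) :
    ∃ e : Perm (Fin n), ∀ y, e (r y) = r' (e y) ∧ e (u y) = u' (e y) := by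
  obtain ⟨hd, l, hl⟩ := h
  obtain ⟨-, l', hl'⟩ := h'
  have := Nat.eq_of_mul_eq_mul_right hd (Nat.add_left_cancel (hl.card_eq.symm.trans hl'.card_eq))
  obtain rfl : l = l' := by omega
  exact hl.exists_equiv hl'

/-- The codes of the surfaces with `n` squares and one cylinder. -/
def oneRowCodes (n : ℕ) : Finset (Σ _ : ℕ, ℕ × ℕ × ℕ) :=
  (Icc 1 n).sigma fun h => range (n / h) ×ˢ range (n / h) ×ˢ range (n / h)

/-- The codes of the surfaces with `n` squares and two cylinders. -/
def twoRowsCodes (n : ℕ) : Finset (Σ _ : ℕ, Σ _ : ℕ, ℕ × ℕ × ℕ) :=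
  (Icc 1 n).sigma fun h₂ => (Ioc h₂ n).sigma fun h =>
    Ioc 0 (n / h) ×ˢ range (n / h) ×ˢ range (n / h₂)

namespace Tiling

variable {n : ℕ} (S : Tiling n)

lemma exists_code (h3 : S.vertexPerm.support.card = 3) :
    (∃ d ∈ oneRowCodes n, OneRowCode S.right S.up d) ∨
      ∃ d ∈ twoRowsCodes n, TwoRowsCode S.right S.up d := by
  obtain ⟨a, L, π, H, C, -⟩ := S.exists_cylinders h3
  rcases C.next_cases with h | ⟨d, h0, h1, h2⟩
  · left
    obtain ⟨t, ht, hR⟩ := C.oneRow h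
    have hc := hR.card_eq
    rw [Nat.card_fin] at hc
    have hd : n / H 0 = L 0 + L 1 + L 2 := Nat.div_eq_of_eq_mul_left (C.H_pos 0) hc
    have := C.L_pos 0
    have := C.L_pos 1
    have := C.L_pos 2
    refine ⟨⟨H 0, L 0, L 1, t⟩, ?_, C.H_pos 0, L 2, hR⟩
    simp only [oneRowCodes, mem_sigma, mem_Icc, mem_product, mem_range, hd]
    refine ⟨⟨C.H_pos 0, ?_⟩, by omega, by omega, ht⟩
    rw [hc]
    exact Nat.le_mul_of_pos_left _ (by omega)
  · right
    have C' := C.rotate d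
    obtain ⟨t₁, ht₁, t₂, ht₂, hL, hR⟩ := C'.twoRows (by simp [h0])
      (by rw [add_comm 1 d, h1]; simp) (by rw [add_comm 2 d, h2]; simp)
    have hc := hR.card_eq
    rw [Nat.card_fin] at hc
    have p1 := C'.H_pos 0
    have p2 := C'.H_pos 1
    have q1 := C'.L_pos 0
    have q2 := C'.L_pos 2
    generalize H (0 + d) = h₁ at *
    generalize H (1 + d) = h₂ at *
    generalize L (0 + d) = w at *
    generalize L (2 + d) = l at *
    refine ⟨⟨h₂, h₁ + h₂, w, t₁, t₂⟩, ?_, p2, l, by simpa using hR⟩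
    have e1 : w * (h₁ + h₂) ≤ n := by nlinarith
    have e2 : (w + l) * h₂ ≤ n := by nlinarith
    have e3 : h₂ ≤ n := le_trans (Nat.le_mul_of_pos_left _ (by omega)) e2
    have e4 : h₁ + h₂ ≤ n := le_trans (Nat.le_mul_of_pos_left _ q1) e1
    have e5 := (Nat.le_div_iff_mul_le (by omega : 0 < h₁ + h₂)).2 e1
    have e6 := (Nat.le_div_iff_mul_le p2).2 e2
    simp only [twoRowsCodes, mem_sigma, mem_Icc, mem_Ioc, mem_product, mem_range]
    exact ⟨⟨p2, e3⟩, ⟨by omega, e4⟩, ⟨q1, e5⟩, by omega, by omega⟩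

end Tiling

/-! ### Codes for surfaces with a horizontal unit saddle -/

/-- One cylinder with a saddle connection of length `1`, coded by the height, the length of the next
saddle connection, and the twist. -/
def UnitOneRowCode {n : ℕ} (r u : Perm (Fin n)) (d : Σ _ : ℕ, ℕ × ℕ) : Prop :=
  OneRowCode r u ⟨d.1, 1, d.2.1, d.2.2⟩

/-- Two cylinders, the short one of circumference `1` and therefore without twist, coded by the
height of the long one, the length of the saddle connection on both its sides, and its twist. -/
def UnitShortCode {n : ℕ} (r u : Perm (Fin n)) (d : Σ _ : ℕ, ℕ × ℕ) : Prop :=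
  TwoRows r u (n - (1 + d.2.1) * d.1) d.1 1 d.2.1 0 d.2.2

/-- Two cylinders whose circumferences differ by `1`, coded by the sum of the heights and the
twists. The circumference of the short one and the height of the long one are the quotient and the
remainder when the number of squares is divided by the sum of the heights. -/
def UnitStepCode {n : ℕ} (r u : Perm (Fin n)) (d : Σ _ : ℕ, ℕ × ℕ) : Prop :=
  TwoRows r u (d.1 - n % d.1) (n % d.1) (n / d.1) 1 d.2.1 d.2.2

/-- A range that contains the codes of all three kinds: a height `h` and two lengths of order
`n / h`. -/
def unitCodes (n : ℕ) : Finset (Σ _ : ℕ, ℕ × ℕ) :=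
  (Icc 1 n).sigma fun h => range (n / h) ×ˢ range (2 * (n / h))

lemma UnitOneRowCode.exists_equiv {n : ℕ} (r u r' u' : Perm (Fin n)) (d : Σ _ : ℕ, ℕ × ℕ)
    (h : UnitOneRowCode r u d) (h' : UnitOneRowCode r' u' d) :
    ∃ e : Perm (Fin n), ∀ y, e (r y) = r' (e y) ∧ e (u y) = u' (e y) :=
  OneRowCode.exists_equiv _ _ _ _ _ h h'

lemma UnitShortCode.exists_equiv {n : ℕ} (r u r' u' : Perm (Fin n)) (d : Σ _ : ℕ, ℕ × ℕ)
    (h : UnitShortCode r u d) (h' : UnitShortCode r' u' d) :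
    ∃ e : Perm (Fin n), ∀ y, e (r y) = r' (e y) ∧ e (u y) = u' (e y) :=
  TwoRows.exists_equiv h h'

lemma UnitStepCode.exists_equiv {n : ℕ} (r u r' u' : Perm (Fin n)) (d : Σ _ : ℕ, ℕ × ℕ)
    (h : UnitStepCode r u d) (h' : UnitStepCode r' u' d) :
    ∃ e : Perm (Fin n), ∀ y, e (r y) = r' (e y) ∧ e (u y) = u' (e y) :=
  TwoRows.exists_equiv h h'

namespace Tiling

variable {n : ℕ} (S : Tiling n)

lemma exists_unit_code (h3 : S.vertexPerm.support.card = 3)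
    (hu : ∃ i ∈ S.vertexPerm.support, S.right i ∈ S.vertexPerm.support) :
    (∃ d ∈ unitCodes n, UnitOneRowCode S.right S.up d) ∨
      (∃ d ∈ unitCodes n, UnitShortCode S.right S.up d) ∨
      ∃ d ∈ unitCodes n, UnitStepCode S.right S.up d := by
  obtain ⟨a, L, π, H, C, hsupp⟩ := S.exists_cylinders h3
  obtain ⟨i, hi, hr⟩ := hu
  obtain ⟨j, rfl⟩ := hsupp i hi
  obtain ⟨k, hk⟩ := hsupp _ hr
  have hLj : L j = 1 := by
    by_contra hL
    exact C.ne_of_lt j 1 one_pos (lt_of_le_of_ne (C.L_pos j) (Ne.symm hL)) k (by simpa using hk)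
  rcases C.next_cases with h | ⟨d, h0, h1, h2⟩
  · left
    have C' := C.rotate j
    obtain ⟨t, ht, hR⟩ := C'.oneRow (fun i => by rw [h]; abel)
    have hc := hR.card_eq
    rw [Nat.card_fin] at hc
    have p := C'.H_pos 0
    have q1 := C'.L_pos 1
    have q2 := C'.L_pos 2
    simp only [zero_add, hLj] at hc p q1 q2 ht hR
    have hd := Nat.div_eq_of_eq_mul_left p hc
    refine ⟨⟨H j, L (1 + j), t⟩, ?_, p, L (2 + j), hR⟩
    simp only [unitCodes, mem_sigma, mem_Icc, mem_product, mem_range, hd]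
    refine ⟨⟨p, ?_⟩, by omega, by omega⟩
    rw [hc]
    exact Nat.le_mul_of_pos_left _ (by omega)
  · right
    have C' := C.rotate d
    obtain ⟨t₁, ht₁, t₂, ht₂, hL, hR⟩ := C'.twoRows (by simp [h0])
      (by rw [add_comm 1 d, h1]; simp) (by rw [add_comm 2 d, h2]; simp)
    have hc := hR.card_eq
    rw [Nat.card_fin] at hc
    have p1 := C'.H_pos 0
    have p2 := C'.H_pos 1
    have q1 := C'.L_pos 0
    have q2 := C'.L_pos 2
    have hLd : L (0 + d) = 1 ∨ L (2 + d) = 1 := by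
      have hmem : ∃ m, m + d = j := ⟨j - d, sub_add_cancel j d⟩
      obtain ⟨m, rfl⟩ := hmem
      fin_cases m
      · exact Or.inl hLj
      · exact Or.inl (hL ▸ hLj)
      · exact Or.inr hLj
    generalize H (0 + d) = h₁ at *
    generalize H (1 + d) = h₂ at *
    generalize L (0 + d) = w at *
    generalize L (2 + d) = l at *
    rcases hLd with rfl | rfl
    · left
      have e2 : (1 + l) * h₂ ≤ n := by omega
      have e3 : h₂ ≤ n := le_trans (Nat.le_mul_of_pos_left _ (by omega)) e2
      have e6 := (Nat.le_div_iff_mul_le p2).2 e2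
      obtain rfl : t₁ = 0 := by omega
      have e7 : n - (1 + l) * h₂ = h₁ := by omega
      refine ⟨⟨h₂, l, t₂⟩, ?_, by rw [UnitShortCode, e7]; exact hR⟩
      simp only [unitCodes, mem_sigma, mem_Icc, mem_product, mem_range]
      exact ⟨⟨p2, e3⟩, by omega, by omega⟩
    · right
      have e1 : h₂ + (h₁ + h₂) * w = n := by rw [hc]; ring
      obtain ⟨e2, e3⟩ := (Nat.div_mod_unique (by omega : 0 < h₁ + h₂)).2
        ⟨e1, by omega⟩
      have e4 : h₁ + h₂ ≤ n := by
        rw [← e1]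
        exact le_add_left (Nat.le_mul_of_pos_right _ q1)
      have e5 : h₁ + h₂ - n % (h₁ + h₂) = h₁ := by omega
      refine ⟨⟨h₁ + h₂, t₁, t₂⟩, ?_, by rw [UnitStepCode, e5, e2, e3]; exact hR⟩
      simp only [unitCodes, mem_sigma, mem_Icc, mem_product, mem_range, e2]
      exact ⟨⟨by omega, e4⟩, by omega, by omega⟩

/-- The surface reflected in the diagonal. -/
def swap : Tiling n where
  right := S.up
  up := S.right
  connected := by
    have := S.connected
    rwa [Set.pair_comm] at this

lemma vertexPerm_swap : S.swap.vertexPerm = S.vertexPerm⁻¹ := by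
  simp only [vertexPerm, swap]
  group

end Tiling

/-! ### Upper bounds -/

section UpperBounds

variable (n : ℕ)

lemma surfacesH2_subset : surfacesH2 n ⊆
    codedSurfaces n OneRowCode (oneRowCodes n) ∪ codedSurfaces n TwoRowsCode (twoRowsCodes n) := by
  rintro _ ⟨S, rfl, hS⟩
  rcases S.exists_code (S.inStratum_iff.1 hS) with h | h
  · exact Or.inl ⟨S, rfl, h⟩
  · exact Or.inr ⟨S, rfl, h⟩

lemma unitSurfacesH2_subset : unitSurfacesH2 n ⊆
    (codedSurfaces n UnitOneRowCode (unitCodes n) ∪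
      (codedSurfaces n UnitShortCode (unitCodes n) ∪ codedSurfaces n UnitStepCode (unitCodes n))) ∪
    (codedSurfaces n (fun r u => UnitOneRowCode u r) (unitCodes n) ∪
      (codedSurfaces n (fun r u => UnitShortCode u r) (unitCodes n) ∪
        codedSurfaces n (fun r u => UnitStepCode u r) (unitCodes n))) := by
  rintro _ ⟨S, rfl, hS, hU⟩
  have h3 := S.inStratum_iff.1 hS
  obtain ⟨i, hi, h | h⟩ := S.exists_of_hasUnitSaddle hU
  · refine Or.inl ?_
    rcases S.exists_unit_code h3 ⟨i, hi, h⟩ with h | h | h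
    · exact Or.inl ⟨S, rfl, h⟩
    · exact Or.inr (Or.inl ⟨S, rfl, h⟩)
    · exact Or.inr (Or.inr ⟨S, rfl, h⟩)
  · refine Or.inr ?_
    have hsupp : S.swap.vertexPerm.support = S.vertexPerm.support := by
      rw [S.vertexPerm_swap, Perm.support_inv]
    rcases S.swap.exists_unit_code (by rwa [hsupp]) ⟨i, by rwa [hsupp], by rwa [hsupp]⟩ with
      h | h | h
    · exact Or.inl ⟨S, rfl, h⟩
    · exact Or.inr (Or.inl ⟨S, rfl, h⟩)
    · exact Or.inr (Or.inr ⟨S, rfl, h⟩)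

lemma sum_inv_sq_le : ∑ h ∈ Icc 1 n, ((h : ℝ) ^ 2)⁻¹ ≤ 2 := by
  rcases Nat.eq_zero_or_pos n with rfl | hn
  · simp
  rw [Icc_eq_cons_Ioc hn, sum_cons]
  have h1 := sum_Ioc_inv_sq_le_sub (α := ℝ) one_ne_zero hn
  have h2 : (0 : ℝ) ≤ (n : ℝ)⁻¹ := by positivity
  rw [Nat.cast_one, inv_one] at h1
  rw [Nat.cast_one, one_pow, inv_one]
  linarith

lemma cast_div_sq_le (h : ℕ) : ((n / h : ℕ) : ℝ) ^ 2 ≤ n ^ 2 * ((h : ℝ) ^ 2)⁻¹ := by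
  rw [← div_eq_mul_inv, ← div_pow]
  exact pow_le_pow_left₀ (by positivity) Nat.cast_div_le 2

lemma sum_div_sq_le : ∑ h ∈ Icc 1 n, ((n / h : ℕ) : ℝ) ^ 2 ≤ 2 * n ^ 2 := by
  calc _ ≤ ∑ h ∈ Icc 1 n, (n : ℝ) ^ 2 * ((h : ℝ) ^ 2)⁻¹ :=
        sum_le_sum fun h _ => cast_div_sq_le n h
    _ = n ^ 2 * ∑ h ∈ Icc 1 n, ((h : ℝ) ^ 2)⁻¹ := by rw [mul_sum]
    _ ≤ n ^ 2 * 2 := by gcongr; exact sum_inv_sq_le n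
    _ = _ := by ring

lemma card_oneRowCodes_le : ((oneRowCodes n).card : ℝ) ≤ 2 * n ^ 3 := by
  simp only [oneRowCodes, card_sigma, card_product, card_range]
  push_cast
  calc _ ≤ ∑ h ∈ Icc 1 n, (n : ℝ) * ((n / h : ℕ) : ℝ) ^ 2 := by
        refine sum_le_sum fun h _ => ?_
        rw [sq]
        gcongr
        exact Nat.div_le_self n h
    _ = n * ∑ h ∈ Icc 1 n, ((n / h : ℕ) : ℝ) ^ 2 := by rw [mul_sum]
    _ ≤ n * (2 * n ^ 2) := by gcongr; exact sum_div_sq_le n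
    _ = _ := by ring

lemma card_twoRowsCodes_le : ((twoRowsCodes n).card : ℝ) ≤ 2 * n ^ 3 := by
  simp only [twoRowsCodes, card_sigma, card_product, card_range, Nat.card_Ioc, Nat.sub_zero]
  push_cast
  calc _ ≤ ∑ h₂ ∈ Icc 1 n, (n : ℝ) ^ 3 * ((h₂ : ℝ) ^ 2)⁻¹ := by
        refine sum_le_sum fun h₂ hh => ?_
        obtain ⟨hh1, hh2⟩ := mem_Icc.1 hh
        calc _ = (∑ h ∈ Ioc h₂ n, ((n / h : ℕ) : ℝ) ^ 2) * ((n / h₂ : ℕ) : ℝ) := by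
              rw [sum_mul]
              exact sum_congr rfl fun h _ => by ring
          _ ≤ (∑ h ∈ Ioc h₂ n, (n : ℝ) ^ 2 * ((h : ℝ) ^ 2)⁻¹) * ((n : ℝ) / h₂) := by
              gcongr with h _
              · exact cast_div_sq_le n h
              · exact Nat.cast_div_le
          _ ≤ ((n : ℝ) ^ 2 * (h₂ : ℝ)⁻¹) * ((n : ℝ) / h₂) := by
              rw [← mul_sum]
              gcongr
              refine (sum_Ioc_inv_sq_le_sub (by omega) hh2).trans ?_
              have : (0 : ℝ) ≤ (n : ℝ)⁻¹ := by positivity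
              linarith
          _ = _ := by
              rw [div_eq_mul_inv, ← inv_pow]
              ring
    _ = n ^ 3 * ∑ h ∈ Icc 1 n, ((h : ℝ) ^ 2)⁻¹ := by rw [mul_sum]
    _ ≤ n ^ 3 * 2 := by gcongr; exact sum_inv_sq_le n
    _ = _ := by ring

lemma card_unitCodes_le : ((unitCodes n).card : ℝ) ≤ 4 * n ^ 2 := by
  simp only [unitCodes, card_sigma, card_product, card_range]
  push_cast
  calc _ = 2 * ∑ h ∈ Icc 1 n, ((n / h : ℕ) : ℝ) ^ 2 := by
        rw [mul_sum]
        exact sum_congr rfl fun h _ => by ring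
    _ ≤ 2 * (2 * n ^ 2) := by gcongr; exact sum_div_sq_le n
    _ = _ := by ring

theorem ncard_surfacesH2_le : ((surfacesH2 n).ncard : ℝ) ≤ 4 * n ^ 3 := by
  have h1 := (Set.ncard_le_ncard (surfacesH2_subset n)).trans (Set.ncard_union_le _ _)
  have h2 := ncard_codedSurfaces_le (n := n) (oneRowCodes n) OneRowCode.exists_equiv
  have h3 := ncard_codedSurfaces_le (n := n) (twoRowsCodes n) TwoRowsCode.exists_equiv
  have h4 : ((surfacesH2 n).ncard : ℝ) ≤ (oneRowCodes n).card + (twoRowsCodes n).card := by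
    exact_mod_cast h1.trans (add_le_add h2 h3)
  linarith [card_oneRowCodes_le n, card_twoRowsCodes_le n]

theorem ncard_unitSurfacesH2_le : ((unitSurfacesH2 n).ncard : ℝ) ≤ 24 * n ^ 2 := by
  have key {R : Perm (Fin n) → Perm (Fin n) → (Σ _ : ℕ, ℕ × ℕ) → Prop}
      (hR : ∀ r u r' u' d, R r u d → R r' u' d →
        ∃ e : Perm (Fin n), ∀ y, e (r y) = r' (e y) ∧ e (u y) = u' (e y)) :
      (codedSurfaces n R (unitCodes n)).ncard ≤ (unitCodes n).card ∧
        (codedSurfaces n (fun r u => R u r) (unitCodes n)).ncard ≤ (unitCodes n).card :=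
    ⟨ncard_codedSurfaces_le _ hR, ncard_codedSurfaces_le _ fun r u r' u' d h h' =>
      (hR u r u' r' d h h').imp fun _ he y => (he y).symm⟩
  have h1 := key UnitOneRowCode.exists_equiv
  have h2 := key UnitShortCode.exists_equiv
  have h3 := key UnitStepCode.exists_equiv
  have h : (unitSurfacesH2 n).ncard ≤ 6 * (unitCodes n).card := by
    refine (Set.ncard_le_ncard (unitSurfacesH2_subset n)).trans ?_
    refine (Set.ncard_union_le _ _).trans ?_
    refine (add_le_add ((Set.ncard_union_le _ _).trans (Nat.add_le_add_left
      (Set.ncard_union_le _ _) _)) ((Set.ncard_union_le _ _).trans (Nat.add_le_add_left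
      (Set.ncard_union_le _ _) _))).trans ?_
    omega
  have h' : ((unitSurfacesH2 n).ncard : ℝ) ≤ 6 * (unitCodes n).card := by exact_mod_cast h
  linarith [card_unitCodes_le n]

end UpperBounds

/-! ### A family of surfaces with one cylinder of height one -/

lemma val_finRotate {n : ℕ} (x : Fin n) :
    (finRotate n x : ℕ) = if (x : ℕ) + 1 = n then 0 else (x : ℕ) + 1 := by
  cases n with
  | zero => exact x.elim0
  | succ n =>
    rw [coe_finRotate]
    simp [Fin.ext_iff]

lemma val_finRotate_pow {n : ℕ} (t : ℕ) (x : Fin n) :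
    ((finRotate n ^ t) x : ℕ) = ((x : ℕ) + t) % n := by
  induction t with
  | zero => simp [Nat.mod_eq_of_lt x.2]
  | succ t ih =>
    rw [← perm_apply_pow, val_finRotate, ih, ← add_assoc, Nat.add_mod_eq_ite (m := x + t)]
    have hn : 0 < n := x.pos
    have := Nat.mod_lt ((x : ℕ) + t) hn
    rcases Nat.lt_or_ge 1 n with h1 | h1
    · rw [Nat.mod_eq_of_lt h1]
      split_ifs <;> omega
    · obtain rfl : n = 1 := by omega
      simp [Nat.mod_one]

/-- The interval exchange that reverses the order of the blocks `[0, c)`, `[c, s)` and `[s, n)`. -/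
def blockReversal {n c s : ℕ} (hc : c ≤ s) (hs : s ≤ n) : Perm (Fin n) where
  toFun x := ⟨if (x : ℕ) < c then x + (n - c) else if (x : ℕ) < s then x - c + (n - s) else x - s,
    by split_ifs <;> omega⟩
  invFun y := ⟨if (y : ℕ) < n - s then y + s else if (y : ℕ) < n - c then y - (n - s) + c else
    y - (n - c), by split_ifs <;> omega⟩
  left_inv x := by
    ext
    simp only
    split_ifs <;> omega
  right_inv y := by
    ext
    simp only
    split_ifs <;> omega

lemma val_blockReversal {n c s : ℕ} (hc : c ≤ s) (hs : s ≤ n) (x : Fin n) :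
    (blockReversal hc hs x : ℕ) =
      if (x : ℕ) < c then x + (n - c) else if (x : ℕ) < s then x - c + (n - s) else x - s := rfl

/-- The surface with one horizontal cylinder of height one, whose lower boundary is divided into
saddle connections by the points `0`, `c` and `s`, and whose twist is `t`. -/
def rowTiling {n c s : ℕ} (hc : c ≤ s) (hs : s ≤ n) (t : ℕ) : Tiling n where
  right := finRotate n
  up := (blockReversal hc hs)⁻¹ * finRotate n ^ t
  connected := by
    refine ⟨fun i j => ⟨⟨finRotate n ^ ((j : ℕ) + n - i), ?_⟩, ?_⟩⟩
    · exact Subgroup.pow_mem _ (Subgroup.subset_closure (Set.mem_insert _ _)) _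
    change (finRotate n ^ ((j : ℕ) + n - i)) i = j
    ext
    rw [val_finRotate_pow, show (i : ℕ) + ((j : ℕ) + n - i) = j + n by omega, Nat.add_mod_right,
      Nat.mod_eq_of_lt j.2]

section RowTiling

variable {n c s : ℕ}

lemma mem_support_rowTiling (hc0 : 0 < c) (hc : c < s) (hs : s < n) (t : ℕ) (i : Fin n) :
    i ∈ (rowTiling hc.le hs.le t).vertexPerm.support ↔
      (i : ℕ) = 0 ∨ (i : ℕ) = c ∨ (i : ℕ) = s := by
  obtain ⟨j, rfl⟩ := (finRotate n).surjective i
  set ψ := blockReversal hc.le hs.le with hψ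
  have hg : (rowTiling hc.le hs.le t).vertexPerm = finRotate n * ψ⁻¹ * (finRotate n)⁻¹ * ψ := by
    simp only [Tiling.vertexPerm, rowTiling, ← hψ]
    group
  have : (rowTiling hc.le hs.le t).vertexPerm (finRotate n j) = finRotate n j ↔
      (ψ (finRotate n j) : ℕ) = finRotate n (ψ j) := by
    rw [hg, ← Fin.ext_iff]
    simp only [Perm.mul_apply, EmbeddingLike.apply_eq_iff_eq, Perm.inv_eq_iff_eq]
  rw [Perm.mem_support, ne_eq, this]
  have h1 := val_blockReversal hc.le hs.le (finRotate n j)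
  have h2 := val_finRotate (ψ j)
  have h3 := val_blockReversal hc.le hs.le j
  have h4 := val_finRotate j
  rw [← hψ] at h1 h3
  have := j.2
  clear this hg
  clear_value ψ
  generalize (ψ (finRotate n j) : ℕ) = x1 at *
  generalize (finRotate n (ψ j) : ℕ) = x2 at *
  generalize (ψ j : ℕ) = x3 at *
  generalize (finRotate n j : ℕ) = x4 at *
  grind

lemma card_support_rowTiling (hc0 : 0 < c) (hc : c < s) (hs : s < n) (t : ℕ) :
    (rowTiling hc.le hs.le t).vertexPerm.support.card = 3 := by
  have : (rowTiling hc.le hs.le t).vertexPerm.support =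
      {⟨0, by omega⟩, ⟨c, by omega⟩, ⟨s, hs⟩} := by
    ext i
    rw [mem_support_rowTiling hc0 hc hs]
    simp [Fin.ext_iff]
  rw [this, card_eq_three]
  refine ⟨_, _, _, ?_, ?_, ?_, rfl⟩ <;> simp only [ne_eq, Fin.mk.injEq] <;> omega

/-- When the saddle connection from `0` to `c` is much shorter than the two others, a relabelling of
the squares has to fix it, so it is trivial. -/
lemma rowTiling_inj {m c' s' t t' : ℕ} (hc0 : 0 < c) (hcm : c ≤ m) (hms : 2 * m < s)
    (hs : s + m < n) (hc0' : 0 < c') (hcm' : c' ≤ m) (hms' : 2 * m < s') (hs' : s' + m < n)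
    (ht : t < n) (ht' : t' < n)
    (h : rowTiling (n := n) (c := c) (s := s) (by omega) (by omega) t ≈
      rowTiling (n := n) (c := c') (s := s') (by omega) (by omega) t') :
    c = c' ∧ s = s' ∧ t = t' := by
  obtain ⟨e, he⟩ := h
  set S := rowTiling (n := n) (c := c) (s := s) (by omega) (by omega) t with hS
  set S' := rowTiling (n := n) (c := c') (s := s') (by omega) (by omega) t' with hS'
  have hg (i : Fin n) (hi : i ∈ S.vertexPerm.support) : e i ∈ S'.vertexPerm.support := by
    rw [Perm.mem_support] at hi ⊢
    obtain ⟨j, rfl⟩ := (S.up * S.right).surjective i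
    rw [Perm.mul_apply, S.vertexPerm_up_right] at hi
    intro h
    rw [Perm.mul_apply, (he _).2, (he _).1, S'.vertexPerm_up_right, ← (he _).2, ← (he _).1,
      ← (he _).1, ← (he _).2] at h
    exact hi (e.injective h)
  let z : Fin n := ⟨0, by omega⟩
  have hpow (x : ℕ) : e ((finRotate n ^ x) z) = (finRotate n ^ x) (e z) := by
    induction x with
    | zero => rfl
    | succ x ih =>
      rw [← perm_apply_pow, ← perm_apply_pow, ← ih]
      exact (he _).1
  have hz (x : Fin n) : (finRotate n ^ (x : ℕ)) z = x := by
    ext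
    rw [val_finRotate_pow]
    simp [z, Nat.mod_eq_of_lt x.2]
  have hval (x : Fin n) : (e x : ℕ) = ((e z : ℕ) + x) % n := by
    conv_lhs => rw [← hz x, hpow, val_finRotate_pow]
  have hsupp (x : ℕ) (hx : x < n) (h : x = 0 ∨ x = c ∨ x = s) :
      ((e z : ℕ) + x) % n = 0 ∨ ((e z : ℕ) + x) % n = c' ∨ ((e z : ℕ) + x) % n = s' := by
    have := hg ⟨x, hx⟩ ((mem_support_rowTiling hc0 (by omega) (by omega) t _).2 h)
    rw [mem_support_rowTiling hc0' (by omega) (by omega), hval] at this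
    exact this
  have h0 := hsupp 0 (by omega) (Or.inl rfl)
  have h1 := hsupp c (by omega) (Or.inr (Or.inl rfl))
  have h2 := hsupp s (by omega) (Or.inr (Or.inr rfl))
  rw [add_zero, Nat.mod_eq_of_lt (e z).2] at h0
  -- neither `c'` nor `s'` is followed by a marked point at distance `c ≤ m`
  have hez : (e z : ℕ) = 0 := by
    rcases h0 with h0 | h0 | h0
    · exact h0
    · rw [h0, Nat.mod_eq_of_lt (by omega)] at h1
      omega
    · rw [h0, Nat.mod_eq_of_lt (by omega)] at h1
      omega
  rw [hez, zero_add, Nat.mod_eq_of_lt (by omega)] at h1 h2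
  obtain rfl : c = c' := by omega
  obtain rfl : s = s' := by omega
  have hid (x : Fin n) : e x = x := by
    ext
    rw [hval, hez, zero_add, Nat.mod_eq_of_lt x.2]
  have hu := (he z).2
  simp only [hid] at hu
  simp only [hS, hS', rowTiling, Perm.mul_apply, EmbeddingLike.apply_eq_iff_eq] at hu
  have hv := congrArg Fin.val hu
  rw [val_finRotate_pow, val_finRotate_pow] at hv
  simp only [z, zero_add, Nat.mod_eq_of_lt ht, Nat.mod_eq_of_lt ht'] at hv
  exact ⟨rfl, rfl, hv⟩

/-- The parameters `(c, s, t)` of a family of pairwise different surfaces. -/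
def rowParameters (n : ℕ) (C : Finset ℕ) : Finset (ℕ × ℕ × ℕ) :=
  C ×ˢ Ico (2 * (n / 4) + 1) (3 * (n / 4)) ×ˢ range n

lemma card_rowParameters_le {C : Finset ℕ} (hC : C ⊆ Icc 1 (n / 4))
    {Q : Set (Quotient (Tiling.setoid n))}
    (hQ : ∀ (c s t : ℕ) (hc : c < s) (hs : s < n), c ∈ C → ⟦rowTiling hc.le hs.le t⟧ ∈ Q) :
    C.card * (n / 4 - 1) * n ≤ Q.ncard := by
  have hcard : (rowParameters n C).card = C.card * (n / 4 - 1) * n := by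
    rw [rowParameters, card_product, card_product, Nat.card_Ico, card_range, mul_assoc]
    congr 2
    omega
  have hmem (p : rowParameters n C) : p.1.1 ∈ C ∧ (0 < p.1.1 ∧ p.1.1 ≤ n / 4) ∧
      (2 * (n / 4) < p.1.2.1 ∧ p.1.2.1 + n / 4 < n) ∧ p.1.2.2 < n := by
    obtain ⟨p, hp⟩ := p
    simp only [rowParameters, mem_product, mem_Ico, mem_range] at hp
    have := mem_Icc.1 (hC hp.1)
    refine ⟨hp.1, ⟨?_, ?_⟩, ⟨?_, ?_⟩, ?_⟩ <;> simp only <;> omega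
  have hlt (p : rowParameters n C) : p.1.1 < p.1.2.1 ∧ p.1.2.1 < n := by
    have := hmem p
    omega
  rw [← hcard, ← Nat.card_eq_finsetCard, ← Nat.card_coe_set_eq]
  let F : rowParameters n C → Q := fun p =>
    ⟨⟦rowTiling (hlt p).1.le (hlt p).2.le p.1.2.2⟧, hQ _ _ _ (hlt p).1 (hlt p).2 (hmem p).1⟩
  refine Nat.card_le_card_of_injective F fun p q h => ?_
  have hp := hmem p
  have hq := hmem q
  obtain ⟨h1, h2, h3⟩ := rowTiling_inj hp.2.1.1 hp.2.1.2 hp.2.2.1.1 hp.2.2.1.2 hq.2.1.1 hq.2.1.2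
    hq.2.2.1.1 hq.2.2.1.2 hp.2.2.2 hq.2.2.2 (Quotient.exact (congrArg Subtype.val h))
  exact Subtype.ext (Prod.ext h1 (Prod.ext h2 h3))

end RowTiling

/-! ### Lower bounds and asymptotics -/

theorem le_ncard_surfacesH2 {n : ℕ} (hn : 16 ≤ n) :
    (n : ℝ) ^ 3 / 64 ≤ (surfacesH2 n).ncard := by
  have h := card_rowParameters_le (n := n) (C := Icc 1 (n / 4)) (Q := surfacesH2 n) subset_rfl
    fun c s t hc hs hcC => ⟨_, rfl, (Tiling.inStratum_iff _).2
      (card_support_rowTiling (mem_Icc.1 hcC).1 hc hs t)⟩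
  rw [Nat.card_Icc, Nat.add_sub_cancel] at h
  have h1 : n ≤ 8 * (n / 4 - 1) := by omega
  have h2 : n * n * n ≤ 64 * (surfacesH2 n).ncard := by
    calc n * n * n ≤ (8 * (n / 4)) * (8 * (n / 4 - 1)) * n := by
          gcongr
          omega
      _ = 64 * (n / 4 * (n / 4 - 1) * n) := by ring
      _ ≤ _ := by gcongr
  have h3 : (n : ℝ) * n * n ≤ 64 * (surfacesH2 n).ncard := by exact_mod_cast h2
  rw [div_le_iff₀ (by norm_num)]
  linarith [show (n : ℝ) ^ 3 = n * n * n by ring]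

theorem le_ncard_unitSurfacesH2 {n : ℕ} (hn : 16 ≤ n) :
    (n : ℝ) ^ 2 / 8 ≤ (unitSurfacesH2 n).ncard := by
  have h := card_rowParameters_le (n := n) (C := {1}) (Q := unitSurfacesH2 n)
    (by simp; omega)
    fun c s t hc hs hcC => by
      obtain rfl := mem_singleton.1 hcC
      refine ⟨_, rfl, (Tiling.inStratum_iff _).2 (card_support_rowTiling one_pos hc hs t), ?_⟩
      refine Tiling.hasUnitSaddle_of_right _ (i := ⟨0, by omega⟩) ?_ ?_
      · rw [mem_support_rowTiling one_pos hc hs]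
        exact Or.inl rfl
      · rw [mem_support_rowTiling one_pos hc hs]
        refine Or.inr (Or.inl ?_)
        change (finRotate n _ : ℕ) = 1
        rw [val_finRotate]
        simp
        omega
  rw [card_singleton, one_mul] at h
  have h1 : n ≤ 8 * (n / 4 - 1) := by omega
  have h2 : n * n ≤ 8 * (unitSurfacesH2 n).ncard := by
    calc n * n ≤ 8 * (n / 4 - 1) * n := by gcongr
      _ = 8 * ((n / 4 - 1) * n) := by ring
      _ ≤ _ := by gcongr
  have h3 : (n : ℝ) * n ≤ 8 * (unitSurfacesH2 n).ncard := by exact_mod_cast h2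
  rw [div_le_iff₀ (by norm_num)]
  linarith [show (n : ℝ) ^ 2 = n * n by ring]

lemma isTheta_of_bounds {f : ℕ → ℕ} {k : ℕ} {A B : ℝ} (hB : 0 < B)
    (hle : ∀ n : ℕ, (f n : ℝ) ≤ A * n ^ k) (hge : ∀ n : ℕ, 16 ≤ n → (n : ℝ) ^ k / B ≤ f n) :
    (fun n => (f n : ℝ)) =Θ[atTop] fun n : ℕ => (n : ℝ) ^ k := by
  constructor
  · refine IsBigO.of_bound A (Eventually.of_forall fun n => ?_)
    rw [Real.norm_of_nonneg (by positivity), Real.norm_of_nonneg (by positivity)]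
    exact hle n
  · refine IsBigO.of_bound B ((eventually_ge_atTop 16).mono fun n hn => ?_)
    rw [Real.norm_of_nonneg (by positivity), Real.norm_of_nonneg (by positivity), mul_comm]
    exact (div_le_iff₀ hB).1 (hge n hn)

lemma unitSurfacesH2_subset_surfacesH2 (n : ℕ) : unitSurfacesH2 n ⊆ surfacesH2 n :=
  fun _ ⟨S, hS, h, _⟩ => ⟨S, hS, h⟩

end SquareTiled

theorem theorem1p4 :
    ((fun n : ℕ => ((SquareTiled.surfacesH2 n).ncard : ℝ)) =Θ[atTop] fun n : ℕ => (n : ℝ) ^ 3) ∧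
    ((fun n : ℕ => ((SquareTiled.unitSurfacesH2 n).ncard : ℝ)) =Θ[atTop]
      fun n : ℕ => (n : ℝ) ^ 2) ∧
    Tendsto (fun n : ℕ =>
        ((SquareTiled.surfacesH2 n \ SquareTiled.unitSurfacesH2 n).ncard : ℝ) /
          ((SquareTiled.surfacesH2 n).ncard : ℝ)) atTop (𝓝 1) := by
  have hN := SquareTiled.isTheta_of_bounds (B := 64) (by norm_num) SquareTiled.ncard_surfacesH2_le
    fun _ => SquareTiled.le_ncard_surfacesH2
  have hU := SquareTiled.isTheta_of_bounds (B := 8) (by norm_num)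
    SquareTiled.ncard_unitSurfacesH2_le fun _ => SquareTiled.le_ncard_unitSurfacesH2
  refine ⟨hN, hU, ?_⟩
  have hlittle : (fun n : ℕ => (n : ℝ) ^ 2) =o[atTop] fun n : ℕ => (n : ℝ) ^ 3 :=
    (isLittleO_pow_pow_atTop_of_lt (by norm_num)).comp_tendsto tendsto_natCast_atTop_atTop
  have hzero := ((hU.1.trans_isLittleO hlittle).trans_isBigO hN.2).tendsto_div_nhds_zero
  have hone := hzero.const_sub 1
  rw [sub_zero] at hone
  refine hone.congr' ((eventually_ge_atTop 16).mono fun n hn => ?_)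
  have hpos : (0 : ℝ) < (SquareTiled.surfacesH2 n).ncard :=
    lt_of_lt_of_le (by positivity) (SquareTiled.le_ncard_surfacesH2 hn)
  have hsum : ((SquareTiled.surfacesH2 n \ SquareTiled.unitSurfacesH2 n).ncard : ℝ) +
      (SquareTiled.unitSurfacesH2 n).ncard = (SquareTiled.surfacesH2 n).ncard := by
    exact_mod_cast Set.ncard_sdiff_add_ncard_of_subset
      (SquareTiled.unitSurfacesH2_subset_surfacesH2 n)
  simp only
  rw [eq_sub_of_add_eq hsum, sub_div, div_self hpos.ne']
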